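/- Let $m\in\mathbb{N}$ and let $V:\mathbb{R}^3\to\mathbb{R}$ be a measurable function such that $V\in L^2_{\mathrm{loc}}(\mathbb{R}^3)$, $V(x)\to 0$ as $|x|\to\infty$, and $V\le 0$. For $u:\mathbb{R}^3\to\mathbb{C}^m$ put $$U_u(x) := -\frac{1}{4\pi}\int_{\mathbb{R}^3}\frac{|u(y)|^2}{|x-y|}\,dy .$$ For $s\in\{0,1,2,\ldots\}$ let $H^s(\mathbb{R}^3,\mathbb{C}^m)$ be the space of all $u\in L^2(\mathbb{R}^3,\mathbb{C}^m)$ whose distributional partial derivatives of order at most $s$ belong to $L^2(\mathbb{R}^3,\mathbb{C}^m)$. Let $\omega\in\mathbb{R}$ with $\omega<0$, and consider the stationary equation $$-\Delta u + V u + U_u u = \omega u. \qquad (*)$$ Suppose that $u\in H^1(\mathbb{R}^3,\mathbb{C}^m)$ is a weak solution of $(*)$, that is, $$\int_{\mathbb{R}^3}\Big[\overline{\nabla u}\cdot\nabla v + (V+U_u)\,\overline{u}\cdot v\Big]dx = \omega\int_{\mathbb{R}^3}\overline{u}\cdot v\,dx\qquad\text{for all } v\in H^1(\mathbb{R}^3,\mathbb{C}^m).$$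 Then $u\in H^2(\mathbb{R}^3,\mathbb{C}^m)$, and $u$ is a strong solution of $(*)$: the integral defining $U_u(x)$ converges for every $x$, the functions $\Delta u$, $Vu$ and $U_u u$ belong to $L^2(\mathbb{R}^3,\mathbb{C}^m)$, and $(*)$ holds in $L^2(\mathbb{R}^3,\mathbb{C}^m)$, that is, almost everywhere. Moreover, if $V\equiv 0$, then $u$ has a representative (it is almost everywhere equal to a function) in $C^\infty(\mathbb{R}^3,\mathbb{C}^m)$, and this representative is a classical solution of $(*)$: the integral defining its gravitational potential converges at every point, and $(*)$ holds at every point of $\mathbb{R}^3$. -/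

import Mathlib

open MeasureTheory Filter Topology
open scoped SchwartzMap LineDeriv Laplacian

namespace SchrodingerPoisson

/-- The physical space `ℝ³` with its Euclidean norm and Lebesgue measure. -/
abbrev Space : Type := EuclideanSpace ℝ (Fin 3)

/-- The target space `ℂᵐ` with its Hermitian inner product, conjugate-linear in the first slot. -/
abbrev Target (m : ℕ) : Type := EuclideanSpace ℂ (Fin m)

/-- `L²(ℝ³, ℂᵐ)`, a space of classes of functions modulo null sets. -/
abbrev L2 (m : ℕ) : Type := Lp (Target m) 2 (volume : Measure Space)

/-- The standard basis vector `eᵢ` of `ℝ³`. -/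
noncomputable def e (i : Fin 3) : Space := EuclideanSpace.single i 1

/-- `u ∈ Hˢ(ℝ³, ℂᵐ)`: all distributional partial derivatives of `u` of order at most `s` are
in `L²`. A multi-index of order `k` is written as the list `α` of the `k` directions. -/
def MemH {m : ℕ} (s : ℕ) (u : L2 m) : Prop :=
  ∀ k : ℕ, k ≤ s → ∀ α : Fin k → Fin 3,
    ∃ g : L2 m, ∂^{fun j => e (α j)} (u : 𝓢'(Space, Target m)) = (g : 𝓢'(Space, Target m))

open Classical in
/-- The distributional partial derivative `∂ᵢ u` as an element of `L²`; it is unique if it exists,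
which is the case for `u ∈ H¹`, and it is set to `0` if it does not. -/
noncomputable def weakPartial {m : ℕ} (i : Fin 3) (u : L2 m) : L2 m :=
  if h : ∃ g : L2 m, ∂_{e i} (u : 𝓢'(Space, Target m)) = (g : 𝓢'(Space, Target m))
  then h.choose else 0

/-- The integrand `y ↦ |u(y)|² / |x - y|` of the gravitational potential at `x`. -/
noncomputable def gravIntegrand {m : ℕ} (u : Space → Target m) (x y : Space) : ℝ :=
  ‖u y‖ ^ 2 / ‖x - y‖

/-- The gravitational potential `U_u(x) = -(1 / 4π) ∫ |u(y)|² / |x - y| dy`. -/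
noncomputable def gravPotential {m : ℕ} (u : Space → Target m) (x : Space) : ℝ :=
  -(1 / (4 * Real.pi)) * ∫ y, gravIntegrand u x y

/-- The assumptions on the external potential: `V` is (Lebesgue) measurable and in `L²_loc`,
`V(x) → 0` as `|x| → ∞`, and `V ≤ 0`. -/
structure IsAdmissiblePotential (V : Space → ℝ) : Prop where
  aemeasurable : AEMeasurable V volume
  memLp_loc : ∀ K : Set Space, IsCompact K → MemLp V 2 (volume.restrict K)
  tendsto_zero : Tendsto V (cocompact Space) (𝓝 0)
  nonpos : ∀ x, V x ≤ 0

/-- The form `B[u; v] = ∫ (∇u̅ · ∇v + (V + U_u) u̅ · v) dx`. -/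
noncomputable def formB {m : ℕ} (V : Space → ℝ) (u v : L2 m) : ℂ :=
  ∫ x, ((∑ i : Fin 3, inner ℂ (weakPartial i u x) (weakPartial i v x))
    + ((V x + gravPotential u x : ℝ) : ℂ) * inner ℂ (u x) (v x))

/-- `u ∈ H¹` is a weak solution of `-Δu + V u + U_u u = ω u`:
`B[u; v] = ω (u, v)` for all `v ∈ H¹`. -/
def IsWeakSolution {m : ℕ} (V : Space → ℝ) (ω : ℝ) (u : L2 m) : Prop :=
  MemH 1 u ∧ ∀ v : L2 m, MemH 1 v → formB V u v = (ω : ℂ) * ∫ x, inner ℂ (u x) (v x)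

/-- `u` is a strong solution of `-Δu + V u + U_u u = ω u`: it is in `H²`, the potential `U_u` is
given by a convergent integral, `Δu`, `V u` and `U_u u` are in `L²`, and the equation holds
in `L²`, that is, almost everywhere. -/
def IsStrongSolution {m : ℕ} (V : Space → ℝ) (ω : ℝ) (u : L2 m) : Prop :=
  MemH 2 u ∧ (∀ x, Integrable (gravIntegrand u x)) ∧
    MemLp (fun x => V x • u x) 2 volume ∧ MemLp (fun x => gravPotential u x • u x) 2 volume ∧
    ∃ Lu : L2 m, Δ (u : 𝓢'(Space, Target m)) = (Lu : 𝓢'(Space, Target m)) ∧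
      ∀ᵐ x, -Lu x + V x • u x + gravPotential u x • u x = ω • u x

/-- The function `w` is a classical solution of `-Δw + V w + U_w w = ω w`: it is twice
continuously differentiable, `U_w` is given by a convergent integral, and the equation holds
at every point. -/
def IsClassicalSolution {m : ℕ} (V : Space → ℝ) (ω : ℝ) (w : Space → Target m) : Prop :=
  ContDiff ℝ 2 w ∧ (∀ x, Integrable (gravIntegrand w x)) ∧
    ∀ x, -(Δ w) x + V x • w x + gravPotential w x • w x = ω • w x

end SchrodingerPoisson

/-! ### Fourier multipliers on L² and the form of 1 - (2π)⁻²Δ -/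

namespace SchrodingerPoisson

open FourierTransform TemperedDistribution
open scoped ENNReal ComplexConjugate ContDiff

/-! Regularity in H². Put c = (2π)⁻² and R = (1 - cΔ)⁻¹, a self-adjoint Fourier multiplier on L²
with range in H². By `inner_add_sum_inner_weakPartial`, testing the form with v = Rh turns the weak
equation into ⟨u, h⟩ + ∫⟨u, W Rh⟩ = (1 + cω)⟨u, Rh⟩ for all h in L², where W = c(V + U_u). In
dimension three R maps L² into L∞ (`exists_resolvent_bound`), so W₁R is bounded on L² for W₁ in L²,
with small norm when W₁ is small. Both V and U_u lie in L² + L∞ (`exists_gravPotential_bound`), and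
truncation makes the L² part as small as desired (`isKato_of_norm_le`). Hence 1 + W₁R is invertible,
and duality gives u = Rk with k in L² (`exists_eq_resolvent`). So u is in H² and bounded; then U_u
converges everywhere and is bounded, and Vu is in L² because every other term of the equation is.

Smoothness for V = 0. The bounded functions u and U = U_u solve, weakly, Δu = (U - ω)u and ΔU =
C|u|² with a constant C. The kernel 1/|x| is a fundamental solution up to a factor
(`integral_newtonKernel_mul_laplacian`); cutting it off gives a compactly supported parametrix, and
every bounded weak solution of Δv = f is a multiple of (χ/|x|) ∗ f + Δ((1 - χ)/|x|) ∗ v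
(`ae_eq_parametrix_of_weak`). The second term is always smooth. The first has one derivative more
than f, because the gradient of χ/|x| is integrable with compact support
(`contDiff_parametrix_succ`). An induction on the order of differentiability, run for u and U
together, gives smoothness (`exists_contDiff_of_weak`). -/

theorem toTemperedDistribution_injective {m : ℕ} {f g : L2 m}
    (h : (f : 𝓢'(Space, Target m)) = (g : 𝓢'(Space, Target m))) : f = g := by
  have hk := Lp.ker_toTemperedDistributionCLM_eq_bot (F := Target m)
    (μ := (volume : Measure Space)) (p := 2)
  exact LinearMap.ker_eq_bot.1 hk h

theorem memLp_top_of_symbol {g : Space → ℂ} (hg : g.HasTemperateGrowth) {C : ℝ}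
    (hC : ∀ x, ‖g x‖ ≤ C) : MemLp g ⊤ (volume : Measure Space) :=
  memLp_top_of_bound hg.1.continuous.aestronglyMeasurable C (Eventually.of_forall hC)

/-- The Fourier multiplier on `L²` with a bounded symbol. -/
noncomputable def multiplier (m : ℕ) {g : Space → ℂ} (hg : MemLp g ⊤ (volume : Measure Space)) :
    L2 m →L[ℂ] L2 m :=
  ((Lp.fourierTransformₗᵢ Space (Target m)).symm.toContinuousLinearEquiv : L2 m →L[ℂ] L2 m) ∘L
    ((ContinuousLinearMap.lsmul ℂ ℂ).holderL volume ⊤ 2 2 (hg.toLp g)) ∘L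
    ((Lp.fourierTransformₗᵢ Space (Target m)).toContinuousLinearEquiv : L2 m →L[ℂ] L2 m)

theorem multiplier_apply {m : ℕ} {g : Space → ℂ} (hg : MemLp g ⊤ (volume : Measure Space))
    (f : L2 m) : multiplier m hg f = 𝓕⁻ ((hg.toLp g) • (𝓕 f) : L2 m) := rfl

theorem multiplier_toTemperedDistribution {m : ℕ} {g : Space → ℂ}
    (hg : MemLp g ⊤ (volume : Measure Space)) (hg' : g.HasTemperateGrowth) (f : L2 m) :
    ((multiplier m hg f : L2 m) : 𝓢'(Space, Target m)) =
      fourierMultiplierCLM (Target m) g (f : 𝓢'(Space, Target m)) := by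
  rw [multiplier_apply, ← Lp.fourierInv_toTemperedDistribution_eq,
    Lp.toTemperedDistribution_smul_eq hg', fourierMultiplierCLM_apply,
    Lp.fourier_toTemperedDistribution_eq]

theorem inner_multiplier_left {m : ℕ} {g g' : Space → ℂ} (hg : MemLp g ⊤ (volume : Measure Space))
    (hg' : MemLp g' ⊤ (volume : Measure Space)) (hgg' : ∀ x, g' x = conj (g x)) (f h : L2 m) :
    inner ℂ (multiplier m hg f) h = inner ℂ f (multiplier m hg' h) := by
  rw [multiplier_apply, multiplier_apply, ← Lp.inner_fourier_eq, ← Lp.inner_fourier_eq f,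
    fourier_fourierInv_eq, fourier_fourierInv_eq, L2.inner_def, L2.inner_def]
  apply integral_congr_ae
  filter_upwards [Lp.coeFn_lpSMul (r := 2) (hg.toLp g) (𝓕 f), hg.coeFn_toLp,
    Lp.coeFn_lpSMul (r := 2) (hg'.toLp g') (𝓕 h), hg'.coeFn_toLp] with x h1 h2 h3 h4
  rw [h1, h3, Pi.smul_apply', Pi.smul_apply', h2, h4, inner_smul_left, inner_smul_right, hgg']

/-- The symbol of the Bessel potential of order `-2`. -/
noncomputable def besselSymbol (x : Space) : ℂ := (((1 + ‖x‖ ^ 2) ^ (-2 / 2 : ℝ) : ℝ) : ℂ)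

theorem besselSymbol_eq (x : Space) : besselSymbol x = (((1 + ‖x‖ ^ 2)⁻¹ : ℝ) : ℂ) := by
  rw [besselSymbol, show (-2 / 2 : ℝ) = -1 by norm_num, Real.rpow_neg_one]

theorem hasTemperateGrowth_besselSymbol : besselSymbol.HasTemperateGrowth := by
  unfold besselSymbol
  fun_prop

theorem norm_besselSymbol_le (x : Space) : ‖besselSymbol x‖ ≤ 1 := by
  rw [besselSymbol_eq, Complex.norm_real, Real.norm_of_nonneg (by positivity)]
  exact inv_le_one_of_one_le₀ (by nlinarith [sq_nonneg ‖x‖])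

theorem memLp_top_besselSymbol : MemLp besselSymbol ⊤ (volume : Measure Space) :=
  memLp_top_of_symbol hasTemperateGrowth_besselSymbol norm_besselSymbol_le

/-- The squared symbol decays like |ξ|⁻⁴, and 4 exceeds the dimension 3. This is what bounds
elements of the range of the resolvent. -/
theorem memLp_two_besselSymbol : MemLp besselSymbol 2 (volume : Measure Space) := by
  have hc : Continuous besselSymbol := hasTemperateGrowth_besselSymbol.1.continuous
  rw [memLp_two_iff_integrable_sq_norm hc.aestronglyMeasurable]
  have h := integrable_rpow_neg_one_add_norm_sq (E := Space) (μ := volume) (r := 4)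
    (by simp; norm_num)
  refine h.congr (Eventually.of_forall fun x => ?_)
  simp only
  rw [besselSymbol_eq, Complex.norm_real, Real.norm_of_nonneg (by positivity),
    show (-4 / 2 : ℝ) = -(2 : ℕ) by norm_num, Real.rpow_neg (by positivity), Real.rpow_natCast,
    inv_pow]

/-- The resolvent `(1 - (2π)⁻² Δ)⁻¹` on `L²`. -/
noncomputable def resolvent (m : ℕ) : L2 m →L[ℂ] L2 m := multiplier m memLp_top_besselSymbol

theorem resolvent_toTemperedDistribution {m : ℕ} (f : L2 m) :
    ((resolvent m f : L2 m) : 𝓢'(Space, Target m)) =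
      besselPotential Space (Target m) (-2) (f : 𝓢'(Space, Target m)) :=
  multiplier_toTemperedDistribution _ hasTemperateGrowth_besselSymbol f

theorem inner_resolvent_left {m : ℕ} (f h : L2 m) :
    inner ℂ (resolvent m f) h = inner ℂ f (resolvent m h) :=
  inner_multiplier_left _ _ (fun x => by rw [besselSymbol_eq, Complex.conj_ofReal]) f h

theorem memSobolev_iteratedLineDerivOp {m : ℕ} (k : ℕ) (α : Fin k → Space) {s : ℝ}
    {f : 𝓢'(Space, Target m)} (hf : MemSobolev s 2 f) : MemSobolev (s - k) 2 (∂^{α} f) := by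
  induction k with
  | zero => simpa using hf
  | succ k ih =>
    rw [LineDeriv.iteratedLineDerivOp_succ_left]
    rw [show s - ((k + 1 : ℕ) : ℝ) = s - k - 1 by push_cast; ring]
    exact (ih (Fin.tail α)).lineDerivOp

theorem memH_of_memSobolev {m : ℕ} (s : ℕ) {u : L2 m}
    (hu : MemSobolev s 2 (u : 𝓢'(Space, Target m))) : MemH s u := by
  intro k hk α
  have h := memSobolev_iteratedLineDerivOp k (fun j => e (α j)) hu
  have h0 : MemSobolev 0 2 (∂^{fun j => e (α j)} (u : 𝓢'(Space, Target m))) :=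
    h.mono (by simpa using hk)
  exact memSobolev_zero_iff.1 h0

theorem memH_mono {m : ℕ} {s t : ℕ} (hst : s ≤ t) {u : L2 m} (hu : MemH t u) : MemH s u :=
  fun k hk => hu k (hk.trans hst)

theorem memH_resolvent {m : ℕ} (f : L2 m) : MemH 2 (resolvent m f) := by
  apply memH_of_memSobolev
  refine ⟨f, ?_⟩
  rw [resolvent_toTemperedDistribution, besselPotential_besselPotential_apply]
  simp

theorem MemH.exists_lineDeriv {m : ℕ} {u : L2 m} (hu : MemH 1 u) (i : Fin 3) :
    ∃ g : L2 m, ∂_{e i} (u : 𝓢'(Space, Target m)) = (g : 𝓢'(Space, Target m)) := by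
  obtain ⟨g, hg⟩ := hu 1 le_rfl (fun _ => i)
  exact ⟨g, by rw [← hg, LineDeriv.iteratedLineDerivOp_one]⟩

theorem MemH.weakPartial_eq {m : ℕ} {u : L2 m} (hu : MemH 1 u) (i : Fin 3) :
    ∂_{e i} (u : 𝓢'(Space, Target m)) = (weakPartial i u : 𝓢'(Space, Target m)) := by
  have h := hu.exists_lineDeriv i
  rw [weakPartial, dif_pos h]
  exact h.choose_spec

theorem hasTemperateGrowth_coord (i : Fin 3) :
    (fun x : Space => ((inner ℝ x (e i) : ℝ) : ℂ)).HasTemperateGrowth := by fun_prop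

theorem norm_coord_mul_besselSymbol_le (i : Fin 3) (x : Space) :
    ‖((inner ℝ x (e i) : ℝ) : ℂ) * besselSymbol x‖ ≤ 1 := by
  rw [norm_mul, besselSymbol_eq, Complex.norm_real, Complex.norm_real,
    Real.norm_of_nonneg (r := (1 + ‖x‖ ^ 2)⁻¹) (by positivity), mul_inv_le_iff₀ (by positivity)]
  have h : ‖(inner ℝ x (e i) : ℝ)‖ ≤ ‖x‖ * ‖e i‖ := norm_inner_le_norm _ _
  have h1 : ‖e i‖ = 1 := by simp [e]
  rw [h1] at h
  nlinarith [sq_nonneg (‖x‖ - 1)]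

theorem memLp_top_coord_mul_besselSymbol (i : Fin 3) :
    MemLp (fun x : Space => ((inner ℝ x (e i) : ℝ) : ℂ) * besselSymbol x) ⊤ volume :=
  memLp_top_of_symbol ((hasTemperateGrowth_coord i).mul hasTemperateGrowth_besselSymbol)
    (norm_coord_mul_besselSymbol_le i)

/-- The multiplier `ξᵢ (1 + |ξ|²)⁻¹`. -/
noncomputable def gradResolvent (m : ℕ) (i : Fin 3) : L2 m →L[ℂ] L2 m :=
  multiplier m (memLp_top_coord_mul_besselSymbol i)

theorem weakPartial_resolvent {m : ℕ} (f : L2 m) (i : Fin 3) :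
    weakPartial i (resolvent m f) = (2 * Real.pi * Complex.I : ℂ) • gradResolvent m i f := by
  apply toTemperedDistribution_injective
  rw [← (memH_mono one_le_two (memH_resolvent f)).weakPartial_eq i,
    resolvent_toTemperedDistribution, lineDeriv_eq_fourierMultiplierCLM]
  rw [← Lp.toTemperedDistributionCLM_apply (_ • _), map_smul, Lp.toTemperedDistributionCLM_apply,
    gradResolvent, multiplier_toTemperedDistribution _
      ((hasTemperateGrowth_coord i).mul hasTemperateGrowth_besselSymbol)]
  congr 1
  erw [fourierMultiplierCLM_fourierMultiplierCLM_apply hasTemperateGrowth_besselSymbol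
    (hasTemperateGrowth_coord i)]
  rw [mul_comm]

theorem sum_coord_sq (x : Space) : ∑ i, (inner ℝ x (e i)) ^ 2 = ‖x‖ ^ 2 := by
  simp [e, EuclideanSpace.norm_sq_eq, EuclideanSpace.inner_single_right]

/-- The form of `1 - (2π)⁻² Δ` on `H¹ × H²`. -/
theorem inner_add_sum_inner_weakPartial {m : ℕ} {u : L2 m} (hu : MemH 1 u) (h : L2 m) :
    inner ℂ u (resolvent m h) + (((2 * Real.pi) ^ 2)⁻¹ : ℝ) *
      ∑ i, inner ℂ (weakPartial i u) (weakPartial i (resolvent m h)) = inner ℂ u h := by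
  have hpi : (2 * Real.pi : ℂ) ≠ 0 := by
    have := Real.pi_ne_zero
    simp
  -- On the Fourier side ∂ᵢ is 2πi ξᵢ, so this is (1 + |ξ|²)⁻¹ + ∑ ξᵢ²(1 + |ξ|²)⁻¹ = 1. Only first
  -- derivatives of `u` occur; pairing with `h` and moving the real multipliers across then yields
  -- the form.
  have key : resolvent m u + ∑ i, (-(2 * Real.pi * Complex.I)⁻¹ : ℂ) •
      (-1 : ℂ) • gradResolvent m i (weakPartial i u) = u := by
    apply toTemperedDistribution_injective
    have h1 : ∀ i, Lp.toTemperedDistributionCLM (Target m) (volume : Measure Space) 2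
        (gradResolvent m i (weakPartial i u)) = (2 * Real.pi * Complex.I : ℂ) •
        fourierMultiplierCLM (Target m)
          (fun x => ((inner ℝ x (e i) : ℝ) : ℂ) ^ 2 * besselSymbol x)
          (u : 𝓢'(Space, Target m)) := by
      intro i
      rw [Lp.toTemperedDistributionCLM_apply, gradResolvent, multiplier_toTemperedDistribution _
        ((hasTemperateGrowth_coord i).mul hasTemperateGrowth_besselSymbol), ← hu.weakPartial_eq i,
        lineDeriv_eq_fourierMultiplierCLM, map_smul]
      congr 1
      erw [fourierMultiplierCLM_fourierMultiplierCLM_apply (hasTemperateGrowth_coord i)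
        ((hasTemperateGrowth_coord i).mul hasTemperateGrowth_besselSymbol)]
      congr 2
      ext x
      simp only [Pi.mul_apply]
      ring
    rw [← Lp.toTemperedDistributionCLM_apply, map_add, map_sum]
    simp only [map_smul, h1]
    have h2 : ∀ T : 𝓢'(Space, Target m), (-(2 * Real.pi * Complex.I)⁻¹ : ℂ) • (-1 : ℂ) •
        (2 * Real.pi * Complex.I : ℂ) • T = T := by
      intro T
      rw [smul_smul, smul_smul]
      convert one_smul ℂ T
      field_simp [Complex.I_ne_zero]
    simp only [h2]
    have ht : ∀ i ∈ (Finset.univ : Finset (Fin 3)),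
        (fun x : Space => ((inner ℝ x (e i) : ℝ) : ℂ) ^ 2 * besselSymbol x).HasTemperateGrowth :=
      fun i _ => ((hasTemperateGrowth_coord i).pow 2).mul hasTemperateGrowth_besselSymbol
    rw [Lp.toTemperedDistributionCLM_apply, resolvent_toTemperedDistribution,
      ← _root_.sum_apply, ← fourierMultiplierCLM_sum _ ht]
    change fourierMultiplierCLM (Target m) besselSymbol _ + _ = _
    have h3 := fourierMultiplierCLM_sum (E := Space) (Target m) (ι := Fin 2)
      (g := ![besselSymbol, fun x => ∑ i, ((inner ℝ x (e i) : ℝ) : ℂ) ^ 2 * besselSymbol x])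
      (s := Finset.univ) (by
        intro i _
        fin_cases i
        · exact hasTemperateGrowth_besselSymbol
        · exact Function.HasTemperateGrowth.sum ht)
    simp only [Fin.sum_univ_two, Matrix.cons_val_zero, Matrix.cons_val_one] at h3
    rw [← _root_.add_apply, ← h3]
    convert congrFun (congrArg DFunLike.coe
      (fourierMultiplierCLM_const (E := Space) (F := Target m) 1)) (u : 𝓢'(Space, Target m))
      using 2
    · congr 1
      ext x
      have hx : ∑ i, ((inner ℝ x (e i) : ℝ) : ℂ) ^ 2 * besselSymbol x
          = ((‖x‖ ^ 2 : ℝ) : ℂ) * besselSymbol x := by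
        rw [← Finset.sum_mul, ← sum_coord_sq x]
        push_cast
        rfl
      rw [hx, besselSymbol_eq]
      have h4 : (1 + ‖x‖ ^ 2 : ℝ) ≠ 0 := by positivity
      norm_cast
      field_simp
    · simp
  have hsymm : ∀ i, ∀ f : L2 m,
      inner ℂ (gradResolvent m i f) h = inner ℂ f (gradResolvent m i h) := fun i f =>
    inner_multiplier_left _ _ (fun x => by
      rw [map_mul, besselSymbol_eq, Complex.conj_ofReal, Complex.conj_ofReal]) f h
  conv_rhs => rw [← key]
  rw [inner_add_left, sum_inner, inner_resolvent_left, Finset.mul_sum]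
  congr 1
  refine Finset.sum_congr rfl fun i _ => ?_
  rw [weakPartial_resolvent, inner_smul_right, inner_smul_left, inner_smul_left, hsymm]
  simp only [map_neg, map_inv₀, map_mul, Complex.conj_ofReal, Complex.conj_I, map_one,
    Complex.conj_ofNat]
  push_cast
  field_simp [Complex.I_ne_zero]
  ring_nf
  try simp

end SchrodingerPoisson

/-! ### Boundedness of the resolvent into L∞ and regularity by duality -/

namespace SchrodingerPoisson

open FourierTransform TemperedDistribution
open scoped ENNReal ComplexConjugate ContDiff

/-- A real test function as a Schwartz function. -/
noncomputable def testFunction {φ : Space → ℝ} (hφ : ContDiff ℝ ∞ φ) (hc : HasCompactSupport φ) :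
    𝓢(Space, ℂ) :=
  HasCompactSupport.toSchwartzMap (f := Complex.ofRealCLM ∘ φ) (hc.comp_left rfl) (by fun_prop)

@[simp]
theorem testFunction_apply {φ : Space → ℝ} (hφ : ContDiff ℝ ∞ φ) (hc : HasCompactSupport φ)
    (x : Space) : testFunction hφ hc x = (φ x : ℂ) := rfl

theorem toTemperedDistribution_testFunction {m : ℕ} {p : ℝ≥0∞} [Fact (1 ≤ p)]
    (u : Lp (Target m) p (volume : Measure Space))
    {φ : Space → ℝ} (hφ : ContDiff ℝ ∞ φ) (hc : HasCompactSupport φ) :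
    (u : 𝓢'(Space, Target m)) (testFunction hφ hc) = ∫ x, φ x • u x := by
  rw [Lp.toTemperedDistribution_apply]
  simp only [testFunction_apply, Complex.coe_smul]

theorem integral_fourierInv_smul_eq {m : ℕ} {f : Space → ℂ} {g : Space → Target m}
    (hf : Integrable f) (hg : Integrable g) :
    ∫ x, (𝓕⁻ f) x • g x = ∫ x, f x • (𝓕⁻ g) x := by
  have h := VectorFourier.integral_fourierIntegral_smul_eq_flip (L := -innerₗ Space)
    (μ := volume) (ν := volume) (f := f) (g := g)
    Real.continuous_fourierChar (by
      simpa using (by fun_prop : Continuous fun p : Space × Space => -(inner ℝ p.1 p.2 : ℝ))) hf hg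
  have hL : (-innerₗ Space).flip = -innerₗ Space := by
    ext x y
    simp [real_inner_comm]
  rw [hL] at h
  exact h

theorem norm_fourierInv_le {m : ℕ} (g : Space → Target m) (x : Space) :
    ‖(𝓕⁻ g) x‖ ≤ ∫ y, ‖g y‖ :=
  VectorFourier.norm_fourierIntegral_le_integral_norm _ _ _ _ _

/-- The space `H²` is embedded in `L∞`. -/
theorem exists_resolvent_bound (m : ℕ) :
    ∃ C : ℝ, 0 < C ∧ ∀ h : L2 m, ∀ᵐ x, ‖resolvent m h x‖ ≤ C * ‖h‖ := by
  set b : Lp ℂ 2 (volume : Measure Space) := memLp_two_besselSymbol.toLp besselSymbol with hb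
  refine ⟨‖b‖ + 1, by positivity, fun h => ?_⟩
  set g : Lp (Target m) 1 (volume : Measure Space) := b • (𝓕 h) with hgdef
  have hg : ⇑g =ᵐ[volume] fun x => besselSymbol x • (𝓕 h : L2 m) x := by
    filter_upwards [Lp.coeFn_lpSMul (r := 1) b (𝓕 h), memLp_two_besselSymbol.coeFn_toLp]
      with x h1 h2
    rw [h1, Pi.smul_apply', hb, h2]
  have hint : Integrable g := L1.integrable_coeFn g
  have hnorm : ∫ y, ‖g y‖ ≤ ‖b‖ * ‖h‖ := by
    rw [← L1.norm_eq_integral_norm, ← Lp.norm_fourier_eq h]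
    exact Lp.norm_smul_le b (𝓕 h)
  have hcont : Continuous (𝓕⁻ (g : Space → Target m)) := by
    rw [Real.fourierInv_eq_fourier_comp_neg]
    exact VectorFourier.fourierIntegral_continuous Real.continuous_fourierChar
      (by exact continuous_inner) hint.comp_neg
  -- The L² inverse transform is identified with the Fourier integral of the L¹ function `g` by
  -- pairing both with test functions.
  have hae : ∀ᵐ x, resolvent m h x = (𝓕⁻ (g : Space → Target m)) x := by
    refine ae_eq_of_integral_contDiff_smul_eq ((Lp.memLp _).locallyIntegrable one_le_two)
      hcont.locallyIntegrable fun φ hφ hc => ?_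
    rw [← toTemperedDistribution_testFunction _ hφ hc, resolvent_toTemperedDistribution,
      besselPotential, fourierMultiplierCLM_apply, Lp.fourier_toTemperedDistribution_eq,
      fourierInv_apply]
    change smulLeftCLM (Target m) besselSymbol _ _ = _
    rw [← Lp.toTemperedDistribution_smul_eq (r := 1) hasTemperateGrowth_besselSymbol
      memLp_two_besselSymbol, ← hb, ← hgdef, Lp.toTemperedDistribution_apply,
      SchwartzMap.fourierInv_coe, integral_fourierInv_smul_eq (SchwartzMap.integrable _) hint]
    simp only [testFunction_apply, Complex.coe_smul]
  filter_upwards [hae] with x hx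
  rw [hx]
  refine (norm_fourierInv_le _ _).trans (hnorm.trans ?_)
  nlinarith [norm_nonneg h]

/-- Multiplication by a small `L²` function after the resolvent is a small operator on `L²`. -/
theorem exists_smul_resolvent (m : ℕ) : ∃ ε : ℝ, 0 < ε ∧ ∀ W : Space → ℝ, MemLp W 2 volume →
    eLpNorm W 2 volume ≤ ENNReal.ofReal ε → ∃ T : L2 m →L[ℂ] L2 m, ‖T‖ < 1 ∧
      ∀ h : L2 m, T h =ᵐ[volume] fun x => W x • resolvent m h x := by
  obtain ⟨C, hC, hb⟩ := exists_resolvent_bound m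
  -- With `C` the L² to L∞ bound of the resolvent, this threshold makes the operator norm at most
  -- 1/2.
  refine ⟨(2 * C)⁻¹, by positivity, fun W hW hWε => ?_⟩
  have hle : ∀ h : L2 m, ∀ᵐ x, ‖W x • resolvent m h x‖ ≤ (C * ‖h‖) * ‖W x‖ := fun h => by
    filter_upwards [hb h] with x hx
    rw [norm_smul, mul_comm]
    gcongr
  have hmem : ∀ h : L2 m, MemLp (fun x => W x • resolvent m h x) 2 volume := fun h =>
    hW.of_le_mul (hW.1.smul (Lp.aestronglyMeasurable _)) (hle h)
  let T₀ : L2 m →ₗ[ℂ] L2 m :=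
    { toFun := fun h => (hmem h).toLp _
      map_add' := fun f g => by
        rw [← MemLp.toLp_add]
        apply MemLp.toLp_congr
        rw [map_add]
        filter_upwards [Lp.coeFn_add (resolvent m f) (resolvent m g)] with x hx
        rw [hx, Pi.add_apply, Pi.add_apply, smul_add]
      map_smul' := fun a f => by
        rw [RingHom.id_apply, ← MemLp.toLp_const_smul]
        apply MemLp.toLp_congr
        rw [map_smul]
        filter_upwards [Lp.coeFn_smul a (resolvent m f)] with x hx
        rw [hx, Pi.smul_apply, Pi.smul_apply, smul_comm] }
  have hT₀ : ∀ h, ‖T₀ h‖ ≤ 2⁻¹ * ‖h‖ := fun h => by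
    change ‖(hmem h).toLp _‖ ≤ _
    rw [Lp.norm_toLp]
    refine ENNReal.toReal_le_of_le_ofReal (by positivity) ?_
    refine (eLpNorm_le_mul_eLpNorm_of_ae_le_mul (hle h) 2).trans ?_
    refine (mul_le_mul_right hWε _).trans ?_
    rw [← ENNReal.ofReal_mul (by positivity)]
    apply ENNReal.ofReal_le_ofReal
    apply le_of_eq
    field_simp
  refine ⟨T₀.mkContinuous 2⁻¹ hT₀, ?_, fun h => (hmem h).coeFn_toLp⟩
  exact (LinearMap.mkContinuous_norm_le _ (by norm_num) _).trans_lt (by norm_num)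

/-- `W` is in `L² + L∞` with an arbitrarily small part in `L²`. -/
def IsKato (W : Space → ℝ) : Prop :=
  ∀ ε : ℝ, 0 < ε → ∃ W₁ W₂ : Space → ℝ, ∃ M : ℝ, (∀ᵐ x, W x = W₁ x + W₂ x) ∧
    MemLp W₁ 2 volume ∧ eLpNorm W₁ 2 volume ≤ ENNReal.ofReal ε ∧
    AEStronglyMeasurable W₂ volume ∧ ∀ᵐ x, ‖W₂ x‖ ≤ M

theorem memLp_smul_of_bound {m : ℕ} {W : Space → ℝ} {M : ℝ}
    (hW : AEStronglyMeasurable W volume) (hM : ∀ᵐ x, ‖W x‖ ≤ M) (u : L2 m) :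
    MemLp (fun x => W x • u x) 2 volume := by
  refine (Lp.memLp u).of_le_mul (c := M) (hW.smul (Lp.aestronglyMeasurable _)) ?_
  filter_upwards [hM] with x hx
  rw [norm_smul]
  gcongr

theorem integrable_inner_L2 {m : ℕ} {f g : Space → Target m} (hf : MemLp f 2 volume)
    (hg : MemLp g 2 volume) : Integrable (fun x => (inner ℂ (f x) (g x) : ℂ)) := by
  refine (L2.integrable_inner (𝕜 := ℂ) (hf.toLp f) (hg.toLp g)).congr ?_
  filter_upwards [hf.coeFn_toLp, hg.coeFn_toLp] with x h1 h2
  rw [h1, h2]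

theorem isKato_smul_resolvent_memLp {m : ℕ} {W : Space → ℝ} (hW : IsKato W) (h : L2 m) :
    MemLp (fun x => W x • resolvent m h x) 2 volume := by
  obtain ⟨ε, hε, hT⟩ := exists_smul_resolvent m
  obtain ⟨W₁, W₂, M, hdec, h1, h1ε, h2, h2M⟩ := hW ε hε
  obtain ⟨T, -, hTW⟩ := hT W₁ h1 h1ε
  refine (((Lp.memLp (T h)).ae_eq (hTW h)).add
    (memLp_smul_of_bound h2 h2M (resolvent m h))).ae_eq ?_
  filter_upwards [hdec] with x hx
  rw [hx, Pi.add_apply, add_smul]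

theorem inner_real_smul_left {m : ℕ} (r : ℝ) (a b : Target m) :
    (inner ℂ (r • a) b : ℂ) = r * inner ℂ a b := by
  rw [← Complex.coe_smul, inner_smul_left, Complex.conj_ofReal]

theorem inner_real_smul_right {m : ℕ} (r : ℝ) (a b : Target m) :
    (inner ℂ a (r • b) : ℂ) = r * inner ℂ a b := by
  rw [← Complex.coe_smul, inner_smul_right]

/-- Elliptic regularity for a form-weak solution in `H¹` of `(1 - c Δ) u + W u = μ u`, by
duality. -/
theorem exists_eq_resolvent {m : ℕ} {W : Space → ℝ} (hW : IsKato W) {μ : ℝ} {u : L2 m}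
    (hu : ∀ h : L2 m, inner ℂ u h + ∫ x, (inner ℂ (u x) (W x • resolvent m h x) : ℂ) =
      μ * inner ℂ u (resolvent m h)) :
    ∃ k : L2 m, u = resolvent m k := by
  obtain ⟨ε, hε, hT⟩ := exists_smul_resolvent m
  obtain ⟨W₁, W₂, M, hdec, h1, h1ε, h2, h2M⟩ := hW ε hε
  obtain ⟨T, hT1, hTW⟩ := hT W₁ h1 h1ε
  have hsurj : Function.Surjective ((1 + T : L2 m →L[ℂ] L2 m) : L2 m → L2 m) := by
    have : IsUnit (1 + T : L2 m →L[ℂ] L2 m) := by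
      have := isUnit_one_sub_of_norm_lt_one (x := -T) (by rwa [norm_neg])
      rwa [sub_neg_eq_add] at this
    exact ((ContinuousLinearMap.isUnit_iff_bijective).1 this).2
  have hW2 : ∀ f : L2 m, MemLp (fun x => W₂ x • f x) 2 volume := memLp_smul_of_bound h2 h2M
  -- Only the bounded part of `W` is moved to the right, since `W₂ u` is known to be in L² while `W₁
  -- u` is not yet. The candidate for `k` solves (1 + T)k = f.
  set f : L2 m := (μ : ℂ) • u - (hW2 u).toLp _ with hf
  obtain ⟨k, hk⟩ := hsurj f
  refine ⟨k, ?_⟩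
  have hTsymm : ∀ g h : L2 m, inner ℂ (T g) (resolvent m h) = inner ℂ (resolvent m g) (T h) := by
    intro g h
    rw [L2.inner_def, L2.inner_def]
    refine integral_congr_ae ?_
    filter_upwards [hTW g, hTW h] with x hx hx'
    rw [hx, hx', inner_real_smul_left, inner_real_smul_right]
  have hu' : ∀ h : L2 m, inner ℂ u ((1 + T : L2 m →L[ℂ] L2 m) h) = inner ℂ f (resolvent m h) := by
    intro h
    have hsplit : ∫ x, (inner ℂ (u x) (W x • resolvent m h x) : ℂ) =
        inner ℂ u (T h) + inner ℂ ((hW2 u).toLp _) (resolvent m h) := by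
      rw [L2.inner_def, L2.inner_def, ← integral_add (L2.integrable_inner _ _)
        (L2.integrable_inner _ _)]
      refine integral_congr_ae ?_
      filter_upwards [hdec, hTW h, (hW2 u).coeFn_toLp] with x hx hx1 hx2
      rw [hx, hx1, hx2, add_smul, inner_add_right, inner_real_smul_left,
        inner_real_smul_right (W₂ x)]
    have h0 := hu h
    rw [hsplit] at h0
    rw [hf, inner_sub_left, inner_smul_left, Complex.conj_ofReal, ← h0]
    simp only [_root_.add_apply, one_apply_eq_self, inner_add_right]
    ring
  -- Symmetry of R and of multiplication by `W₁` gives Rk the same pairings with (1 + T)h as `u`; as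
  -- 1 + T is onto, this determines `u`.
  have hRk : ∀ h : L2 m, inner ℂ (resolvent m k) ((1 + T : L2 m →L[ℂ] L2 m) h) = inner ℂ f (resolvent m h) := by
    intro h
    rw [← hk]
    simp only [_root_.add_apply, one_apply_eq_self, inner_add_right, inner_add_left]
    rw [hTsymm, inner_resolvent_left]
  refine ext_inner_right ℂ fun g => ?_
  obtain ⟨h, rfl⟩ := hsurj g
  rw [hu', hRk]

theorem resolvent_injective (m : ℕ) : Function.Injective (resolvent m) := by
  intro f g hfg
  apply toTemperedDistribution_injective
  have h := congrArg (Lp.toTemperedDistribution (F := Target m) (p := 2)) hfg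
  rw [resolvent_toTemperedDistribution, resolvent_toTemperedDistribution] at h
  have h2 := congrArg (besselPotential Space (Target m) 2) h
  simpa using h2

/-- Once u = Rk is known, Wu is in L², so R can be moved off `h` in every term. Injectivity of R
then identifies `k`, which recovers the equation itself. -/
theorem eq_resolvent_of_weak {m : ℕ} {W : Space → ℝ} (hW : IsKato W) {μ : ℝ} {u : L2 m}
    (hu : ∀ h : L2 m, inner ℂ u h + ∫ x, (inner ℂ (u x) (W x • resolvent m h x) : ℂ) =
      μ * inner ℂ u (resolvent m h)) :
    ∃ hWu : MemLp (fun x => W x • u x) 2 volume,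
      u = resolvent m ((μ : ℂ) • u - hWu.toLp _) := by
  obtain ⟨k, hk⟩ := exists_eq_resolvent hW hu
  have hWu : MemLp (fun x => W x • u x) 2 volume := by
    rw [hk]
    exact isKato_smul_resolvent_memLp hW k
  refine ⟨hWu, ?_⟩
  conv_lhs => rw [hk]
  congr 1
  apply resolvent_injective m
  refine ext_inner_right ℂ fun h => ?_
  have h1 : ∫ x, (inner ℂ (u x) (W x • resolvent m h x) : ℂ) =
      inner ℂ (hWu.toLp _) (resolvent m h) := by
    rw [L2.inner_def]
    refine integral_congr_ae ?_
    filter_upwards [hWu.coeFn_toLp] with x hx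
    rw [hx, inner_real_smul_left, inner_real_smul_right]
  have h2 := hu h
  rw [h1, ← inner_resolvent_left, ← inner_resolvent_left u] at h2
  rw [map_sub, map_smul, inner_sub_left, inner_smul_left, Complex.conj_ofReal, ← h2, ← hk]
  ring

end SchrodingerPoisson

/-! ### The external and gravitational potentials in L² + L∞ -/

namespace SchrodingerPoisson

open FourierTransform TemperedDistribution
open scoped ENNReal ComplexConjugate ContDiff

/-- Split where |a| is large: the tail of an L² function has small L² norm, and there the constant
`M` is absorbed into |a|. -/
theorem isKato_of_norm_le {W a : Space → ℝ} {M : ℝ} (hW : AEStronglyMeasurable W volume)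
    (ha : MemLp a 2 volume) (h : ∀ᵐ x, ‖W x‖ ≤ ‖a x‖ + M) : IsKato W := by
  intro ε hε
  set b := ha.1.mk a with hb
  have hbm : StronglyMeasurable b := ha.1.stronglyMeasurable_mk
  have hb2 : MemLp b 2 volume := ha.ae_eq ha.1.ae_eq_mk
  obtain ⟨N₀, hN₀⟩ := hb2.eLpNorm_indicator_norm_ge_le hbm (ε := ε / 2) (by positivity)
  -- `N ≥ M` gives |W| ≤ 2|b| on `A`, the factor 2 being paid for by `ε / 2`; `N ≥ 1` keeps the
  -- bound off `A` nonnegative.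
  set N := max N₀ (max M 1) with hN
  set A : Set Space := {x | N ≤ ‖b x‖} with hA
  have hAm : MeasurableSet A := measurableSet_le measurable_const hbm.measurable.norm
  have hle : ∀ᵐ x, ‖A.indicator W x‖ ≤ 2 * ‖({x | N₀ ≤ ‖b x‖₊} : Set Space).indicator b x‖ := by
    filter_upwards [h, ha.1.ae_eq_mk] with x hx hx'
    by_cases hxA : x ∈ A
    · have hxN : N ≤ ‖b x‖ := hxA
      have h1 : x ∈ ({x | N₀ ≤ ‖b x‖₊} : Set Space) := (le_max_left N₀ (max M 1)).trans hxN
      have h2 : M ≤ ‖b x‖ := ((le_max_left M 1).trans (le_max_right N₀ _)).trans hxN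
      rw [Set.indicator_of_mem hxA, Set.indicator_of_mem h1]
      rw [hx'] at hx
      linarith
    · rw [Set.indicator_of_notMem hxA, norm_zero]
      positivity
  have hbi : MemLp (({x | N₀ ≤ ‖b x‖₊} : Set Space).indicator b) 2 volume :=
    hb2.indicator (measurableSet_le measurable_const hbm.measurable.nnnorm.coe_nnreal_real)
  refine ⟨A.indicator W, Aᶜ.indicator W, N + max M 0, Eventually.of_forall fun x => ?_, ?_, ?_,
    hW.indicator hAm.compl, ?_⟩
  · exact (congrFun (Set.indicator_self_add_compl A W) x).symm
  · exact hbi.of_le_mul (hW.indicator hAm) hle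
  · refine (eLpNorm_le_mul_eLpNorm_of_ae_le_mul hle 2).trans ?_
    refine (mul_le_mul_right hN₀ _).trans ?_
    rw [← ENNReal.ofReal_mul (by positivity)]
    apply le_of_eq
    congr 1
    ring
  · filter_upwards [h, ha.1.ae_eq_mk] with x hx hx'
    by_cases hxA : x ∈ A
    · rw [Set.indicator_of_notMem (by simpa using hxA), norm_zero]
      have : (0 : ℝ) ≤ N := zero_le_one.trans ((le_max_right _ _).trans (le_max_right _ _))
      positivity
    · rw [Set.indicator_of_mem hxA]
      rw [hx'] at hx
      have h3 : ‖b x‖ < N := not_le.1 hxA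
      linarith [le_max_left M 0]

/-- The truncated kernel `1 / |z|` on the unit ball. -/
noncomputable def nearKernel : Space → ℝ :=
  (Metric.ball (0 : Space) 1).indicator fun z => ‖z‖⁻¹

theorem nearKernel_nonneg (z : Space) : 0 ≤ nearKernel z :=
  Set.indicator_nonneg (fun _ _ => by positivity) z

theorem measurable_nearKernel : Measurable nearKernel :=
  (measurable_norm.inv).indicator measurableSet_ball

theorem inv_norm_le_nearKernel_add_one (z : Space) : ‖z‖⁻¹ ≤ nearKernel z + 1 := by
  by_cases hz : z ∈ Metric.ball (0 : Space) 1
  · rw [nearKernel, Set.indicator_of_mem hz]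
    linarith
  · rw [nearKernel, Set.indicator_of_notMem hz, zero_add]
    exact inv_le_one_of_one_le₀ (by simpa using hz)

theorem integrableOn_ball_rpow (r : ℝ) {α : ℝ} (hα : α < 3) :
    IntegrableOn (fun z : Space => ‖z‖ ^ (-α)) (Metric.ball 0 r) volume := by
  refine integrableOn_ball_of_norm_le_rpow (C := 1) (α := α) (by simp) (by simpa using hα)
    (Eventually.of_forall fun z => ?_) ?_
  · rw [one_mul, Real.norm_of_nonneg (by positivity)]
  · exact (measurable_norm.pow_const _).aestronglyMeasurable

theorem integrable_nearKernel : Integrable nearKernel := by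
  rw [nearKernel, integrable_indicator_iff measurableSet_ball]
  refine (integrableOn_ball_rpow 1 (α := 1) (by norm_num)).congr_fun (fun z _ => ?_)
    measurableSet_ball
  simp only
  rw [Real.rpow_neg_one]

theorem integrable_nearKernel_sq : Integrable fun z => nearKernel z ^ 2 := by
  have h : (fun z => nearKernel z ^ 2) =
      (Metric.ball (0 : Space) 1).indicator fun z => ‖z‖ ^ (-2 : ℝ) := by
    ext z
    by_cases hz : z ∈ Metric.ball (0 : Space) 1
    · rw [nearKernel, Set.indicator_of_mem hz, Set.indicator_of_mem hz,
        show (-2 : ℝ) = -(2 : ℕ) by norm_num, Real.rpow_neg (by positivity), Real.rpow_natCast,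
        inv_pow]
    · rw [nearKernel, Set.indicator_of_notMem hz, Set.indicator_of_notMem hz]
      norm_num
  rw [h, integrable_indicator_iff measurableSet_ball]
  exact integrableOn_ball_rpow 1 (by norm_num)

theorem gravIntegrand_nonneg {m : ℕ} (u : Space → Target m) (x y : Space) :
    0 ≤ gravIntegrand u x y := by
  unfold gravIntegrand
  positivity

theorem gravIntegrand_le {m : ℕ} (u : Space → Target m) (x y : Space) :
    gravIntegrand u x y ≤ ‖u y‖ ^ 2 * nearKernel (x - y) + ‖u y‖ ^ 2 := by
  rw [gravIntegrand, div_eq_mul_inv]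
  nlinarith [inv_norm_le_nearKernel_add_one (x - y), sq_nonneg ‖u y‖]

theorem aestronglyMeasurable_gravIntegrand {m : ℕ} {u : Space → Target m}
    (hu : AEStronglyMeasurable u volume) (x : Space) :
    AEStronglyMeasurable (gravIntegrand u x) volume := by
  have h : gravIntegrand u x = fun y => ‖u y‖ ^ 2 * ‖x - y‖⁻¹ := by
    ext y
    rw [gravIntegrand, div_eq_mul_inv]
  rw [h]
  refine AEStronglyMeasurable.mul (hu.norm.pow 2) ?_
  exact ((measurable_const.sub measurable_id).norm.inv).aestronglyMeasurable

theorem aestronglyMeasurable_gravPotential {m : ℕ} (u : L2 m) :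
    AEStronglyMeasurable (gravPotential u) volume := by
  have h1 : StronglyMeasurable fun p : Space × Space => gravIntegrand u p.1 p.2 := by
    simp only [gravIntegrand, div_eq_mul_inv]
    refine StronglyMeasurable.mul
      (((Lp.stronglyMeasurable u).comp_measurable measurable_snd).norm.pow 2) ?_
    exact ((measurable_fst.sub measurable_snd).norm.inv).stronglyMeasurable
  exact (h1.integral_prod_right.const_mul _).aestronglyMeasurable

theorem integrable_norm_sq {m : ℕ} (u : L2 m) : Integrable fun y => ‖u y‖ ^ 2 :=
  (memLp_two_iff_integrable_sq_norm (Lp.aestronglyMeasurable u)).1 (Lp.memLp u)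

theorem norm_gravPotential_le_of_integrable {m : ℕ} (u : L2 m) {x : Space}
    (h : Integrable fun y => ‖u y‖ ^ 2 * nearKernel (x - y)) :
    Integrable (gravIntegrand u x) ∧ ‖gravPotential u x‖ ≤
      (∫ y, ‖u y‖ ^ 2 * nearKernel (x - y)) + ∫ y, ‖u y‖ ^ 2 := by
  have hi : Integrable (gravIntegrand u x) :=
    (h.add (integrable_norm_sq u)).mono'
      (aestronglyMeasurable_gravIntegrand (Lp.aestronglyMeasurable u) x)
      (Eventually.of_forall fun y => by
        rw [Real.norm_of_nonneg (gravIntegrand_nonneg _ _ _)]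
        exact gravIntegrand_le _ _ _)
  refine ⟨hi, ?_⟩
  rw [gravPotential, norm_mul, ← integral_add h (integrable_norm_sq u), Real.norm_of_nonneg
    (integral_nonneg fun y => gravIntegrand_nonneg _ _ _), norm_neg,
    Real.norm_of_nonneg (by positivity)]
  have h1 : 1 / (4 * Real.pi) ≤ 1 := by
    rw [div_le_one (by positivity)]
    nlinarith [Real.pi_gt_three]
  refine (mul_le_of_le_one_left (integral_nonneg fun y => gravIntegrand_nonneg _ _ _) h1).trans ?_
  exact integral_mono hi (h.add (integrable_norm_sq u)) fun y => gravIntegrand_le _ _ _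

/-- Cauchy–Schwarz for the near part of the gravitational potential. -/
theorem integral_mul_nearKernel_le {m : ℕ} (u : L2 m) {x : Space}
    (h : Integrable fun y => ‖u y‖ ^ 2 * nearKernel (x - y) ^ 2) :
    (Integrable fun y => ‖u y‖ ^ 2 * nearKernel (x - y)) ∧
    ∫ y, ‖u y‖ ^ 2 * nearKernel (x - y) ≤
      √((∫ y, ‖u y‖ ^ 2) * ∫ y, ‖u y‖ ^ 2 * nearKernel (x - y) ^ 2) := by
  have hm1 : AEStronglyMeasurable (fun y => ‖u y‖) volume := (Lp.aestronglyMeasurable u).norm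
  have hm2 : AEStronglyMeasurable (fun y => ‖u y‖ * nearKernel (x - y)) volume :=
    hm1.mul (measurable_nearKernel.comp (measurable_const.sub measurable_id)).aestronglyMeasurable
  have h1 : MemLp (fun y => ‖u y‖) 2 volume := (Lp.memLp u).norm
  have h2 : MemLp (fun y => ‖u y‖ * nearKernel (x - y)) 2 volume := by
    rw [memLp_two_iff_integrable_sq hm2]
    simpa only [mul_pow] using h
  have heq : (fun y => ‖u y‖ ^ 2 * nearKernel (x - y)) =
      fun y => ‖u y‖ * (‖u y‖ * nearKernel (x - y)) := by
    ext y
    ring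
  refine ⟨by rw [heq]; exact h1.integrable_mul h2, ?_⟩
  have h3 := integral_mul_le_Lp_mul_Lq_of_nonneg (μ := volume) Real.HolderConjugate.two_two
    (f := fun y => ‖u y‖) (g := fun y => ‖u y‖ * nearKernel (x - y))
    (Eventually.of_forall fun y => norm_nonneg _)
    (Eventually.of_forall fun y => mul_nonneg (norm_nonneg _) (nearKernel_nonneg _))
    (by simpa using h1) (by simpa using h2)
  rw [heq, Real.sqrt_mul (integral_nonneg fun y => by positivity), Real.sqrt_eq_rpow,
    Real.sqrt_eq_rpow]
  refine h3.trans (le_of_eq ?_)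
  simp only [Real.rpow_two, mul_pow]

/-- The gravitational potential of an `L²` function is in `L² + L∞`. -/
theorem exists_gravPotential_bound {m : ℕ} (u : L2 m) : ∃ a : Space → ℝ, ∃ M : ℝ,
    MemLp a 2 volume ∧ ∀ᵐ x, ‖gravPotential u x‖ ≤ ‖a x‖ + M := by
  -- The squared near kernel |z|⁻² is still integrable in dimension three, so its convolution with
  -- |u|² is in L¹. By Cauchy–Schwarz for the measure |u|² dy, it dominates the square of the near
  -- potential up to the mass of `u`.
  have hi : Integrable fun x => ∫ y, ‖u y‖ ^ 2 * nearKernel (x - y) ^ 2 :=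
    (integrable_norm_sq u).integrable_convolution (ContinuousLinearMap.mul ℝ ℝ)
      integrable_nearKernel_sq
  have hex : ∀ᵐ x, Integrable fun y => ‖u y‖ ^ 2 * nearKernel (x - y) ^ 2 :=
    (integrable_norm_sq u).ae_convolution_exists (ContinuousLinearMap.mul ℝ ℝ)
      integrable_nearKernel_sq
  refine ⟨fun x => √((∫ y, ‖u y‖ ^ 2) * ∫ y, ‖u y‖ ^ 2 * nearKernel (x - y) ^ 2),
    ∫ y, ‖u y‖ ^ 2, ?_, ?_⟩
  · rw [memLp_two_iff_integrable_sq
      (Real.continuous_sqrt.comp_aestronglyMeasurable (hi.1.const_mul _))]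
    refine (hi.const_mul (∫ y, ‖u y‖ ^ 2)).congr (Eventually.of_forall fun x => ?_)
    simp only
    rw [Real.sq_sqrt (mul_nonneg (integral_nonneg fun y => by positivity)
      (integral_nonneg fun y => by positivity))]
  · filter_upwards [hex] with x hx
    obtain ⟨h1, h2⟩ := integral_mul_nearKernel_le u hx
    rw [Real.norm_of_nonneg (Real.sqrt_nonneg _)]
    linarith [(norm_gravPotential_le_of_integrable u h1).2]

/-- The gravitational potential of a bounded `L²` function converges everywhere and is bounded. -/
theorem gravPotential_bounded {m : ℕ} (u : L2 m) {B : ℝ} (hB : ∀ᵐ x, ‖u x‖ ≤ B) :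
    (∀ x, Integrable (gravIntegrand u x)) ∧ ∃ M : ℝ, ∀ x, ‖gravPotential u x‖ ≤ M := by
  have hk : ∀ x : Space, Integrable fun y => nearKernel (x - y) := fun x =>
    integrable_nearKernel.comp_sub_left x
  have hle : ∀ x, ∀ᵐ y, ‖u y‖ ^ 2 * nearKernel (x - y) ≤ B ^ 2 * nearKernel (x - y) := fun x => by
    filter_upwards [hB] with y hy
    have := nearKernel_nonneg (x - y)
    gcongr
  have h1 : ∀ x, Integrable fun y => ‖u y‖ ^ 2 * nearKernel (x - y) := fun x =>
    ((hk x).const_mul (B ^ 2)).mono'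
      (((Lp.aestronglyMeasurable u).norm.pow 2).mul (hk x).1) (by
        filter_upwards [hle x] with y hy
        rwa [Real.norm_of_nonneg (mul_nonneg (by positivity) (nearKernel_nonneg _))])
  refine ⟨fun x => (norm_gravPotential_le_of_integrable u (h1 x)).1,
    B ^ 2 * (∫ y, nearKernel y) + ∫ y, ‖u y‖ ^ 2, fun x => ?_⟩
  refine (norm_gravPotential_le_of_integrable u (h1 x)).2.trans ?_
  gcongr
  rw [← integral_sub_left_eq_self nearKernel volume x, ← integral_const_mul]
  exact integral_mono_ae (h1 x) ((hk x).const_mul _) (hle x)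

/-- An admissible potential is in `L² + L∞`. -/
theorem IsAdmissiblePotential.exists_bound {V : Space → ℝ} (hV : IsAdmissiblePotential V) :
    ∃ a : Space → ℝ, MemLp a 2 volume ∧ ∀ x, ‖V x‖ ≤ ‖a x‖ + 1 := by
  have h1 : ∀ᶠ x in cocompact Space, ‖V x‖ < 1 := by
    have := hV.tendsto_zero.norm
    rw [norm_zero] at this
    exact this.eventually_lt_const one_pos
  obtain ⟨K, hK, hKV⟩ := (hasBasis_cocompact.eventually_iff).1 h1
  refine ⟨K.indicator V, ?_, fun x => ?_⟩
  · rw [memLp_indicator_iff_restrict hK.measurableSet]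
    exact hV.memLp_loc K hK
  · by_cases hx : x ∈ K
    · rw [Set.indicator_of_mem hx]
      linarith
    · rw [Set.indicator_of_notMem hx, norm_zero, zero_add]
      exact (hKV hx).le

end SchrodingerPoisson

/-! ### From weak to strong solutions -/

namespace SchrodingerPoisson

open FourierTransform TemperedDistribution
open scoped ENNReal ComplexConjugate ContDiff

/-- Applying 1 - (2π)⁻²Δ to Rk returns `k`; solve for Δ. -/
theorem laplacian_resolvent {m : ℕ} (k : L2 m) :
    Δ (resolvent m k : 𝓢'(Space, Target m)) =
      ((((2 * Real.pi) ^ 2 : ℝ) : ℂ) • (resolvent m k - k) : L2 m) := by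
  have h1 : besselPotential Space (Target m) 2 (resolvent m k : 𝓢'(Space, Target m)) = k := by
    rw [resolvent_toTemperedDistribution, besselPotential_besselPotential_apply]
    simp
  have ht : (fun x : Space => ((‖x‖ ^ 2 : ℝ) : ℂ)).HasTemperateGrowth := by fun_prop
  have h2 : besselPotential Space (Target m) 2 (resolvent m k : 𝓢'(Space, Target m)) =
      (resolvent m k : 𝓢'(Space, Target m)) + fourierMultiplierCLM (Target m)
        (fun x : Space => ((‖x‖ ^ 2 : ℝ) : ℂ)) (resolvent m k : 𝓢'(Space, Target m)) := by
    have h3 := fourierMultiplierCLM_sum (E := Space) (Target m) (ι := Fin 2)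
      (g := ![fun _ => 1, fun x => ((‖x‖ ^ 2 : ℝ) : ℂ)]) (s := Finset.univ) (by
        intro i _
        fin_cases i
        · exact Function.HasTemperateGrowth.const 1
        · exact ht)
    simp only [Fin.sum_univ_two, Matrix.cons_val_zero, Matrix.cons_val_one] at h3
    have h4 : besselPotential Space (Target m) 2 =
        fourierMultiplierCLM (Target m) fun x : Space => 1 + ((‖x‖ ^ 2 : ℝ) : ℂ) := by
      rw [besselPotential]
      congr 1
      ext x
      rw [div_self two_ne_zero, Real.rpow_one]
      push_cast
      rfl
    rw [h4, h3, _root_.add_apply, fourierMultiplierCLM_const, one_smul]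
    rfl
  have h3 : fourierMultiplierCLM (Target m) (fun x : Space => ((‖x‖ ^ 2 : ℝ) : ℂ))
      (resolvent m k : 𝓢'(Space, Target m)) = (k : 𝓢'(Space, Target m)) - resolvent m k := by
    rw [← h1, h2, add_sub_cancel_left]
  rw [laplacian_eq_fourierMultiplierCLM, h3]
  conv_rhs => rw [← Lp.toTemperedDistributionCLM_apply, map_smul, map_sub,
    Lp.toTemperedDistributionCLM_apply, Lp.toTemperedDistributionCLM_apply]
  rw [Complex.coe_smul, neg_smul, ← smul_neg, neg_sub]

/-- A form-weak solution is in the range of the resolvent and satisfies the equation a.e. -/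
theorem IsWeakSolution.exists_resolvent {m : ℕ} {V : Space → ℝ} (hV : IsAdmissiblePotential V)
    {lam : ℝ} {u : L2 m} (hu : IsWeakSolution V lam u) :
    ∃ k : L2 m, u = resolvent m k ∧ ∃ Lu : L2 m,
      Δ (u : 𝓢'(Space, Target m)) = (Lu : 𝓢'(Space, Target m)) ∧
      ∀ᵐ x, Lu x = (V x + gravPotential u x - lam) • u x := by
  obtain ⟨hu1, hform⟩ := hu
  -- The Fourier normalization makes the resolvent invert 1 - cΔ. So the equation is multiplied by
  -- `c` and `u` is added to both sides, which replaces the eigenvalue by 1 + c·`lam`.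
  set c : ℝ := ((2 * Real.pi) ^ 2)⁻¹ with hc
  have hc0 : c ≠ 0 := by
    have := Real.pi_pos
    positivity
  set W : Space → ℝ := fun x => c * (V x + gravPotential u x) with hW
  have hWm : AEStronglyMeasurable W volume :=
    (hV.aemeasurable.aestronglyMeasurable.add (aestronglyMeasurable_gravPotential u)).const_mul c
  have hK : IsKato W := by
    obtain ⟨a, ha, haV⟩ := hV.exists_bound
    obtain ⟨b, M, hb, hbU⟩ := exists_gravPotential_bound u
    refine isKato_of_norm_le (a := fun x => c * (‖a x‖ + ‖b x‖)) (M := |c| * (1 + M)) hWm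
      ((ha.norm.add hb.norm).const_mul c) ?_
    filter_upwards [hbU] with x hx
    rw [hW, norm_mul, norm_mul, Real.norm_of_nonneg (r := ‖a x‖ + ‖b x‖) (by positivity),
      Real.norm_eq_abs c, ← mul_add]
    gcongr
    refine (norm_add_le _ _).trans ?_
    linarith [haV x]
  have hweak : ∀ h : L2 m, inner ℂ u h + ∫ x, (inner ℂ (u x) (W x • resolvent m h x) : ℂ) =
      ((1 + c * lam : ℝ) : ℂ) * inner ℂ u (resolvent m h) := by
    intro h
    have hv := hform (resolvent m h) (memH_mono one_le_two (memH_resolvent h))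
    have hWv := isKato_smul_resolvent_memLp hK h
    have heq : ∀ x, ((V x + gravPotential u x : ℝ) : ℂ) * (inner ℂ (u x) (resolvent m h x) : ℂ) =
        (c : ℂ)⁻¹ * (inner ℂ (u x) (W x • resolvent m h x) : ℂ) := by
      intro x
      rw [inner_real_smul_right, hW]
      push_cast
      have : (c : ℂ) ≠ 0 := by exact_mod_cast hc0
      field_simp
    rw [formB] at hv
    simp only [heq] at hv
    rw [integral_add (integrable_finsetSum _ fun i _ => L2.integrable_inner _ _)
      ((integrable_inner_L2 (Lp.memLp u) hWv).const_mul _), integral_const_mul,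
      integral_finsetSum _ fun i _ => L2.integrable_inner _ _] at hv
    simp only [← L2.inner_def] at hv
    have h1 := inner_add_sum_inner_weakPartial hu1 h
    rw [← hc] at h1
    rw [← h1]
    have hcC : (c : ℂ) ≠ 0 := by exact_mod_cast hc0
    have h2 := congrArg (fun z : ℂ => (c : ℂ) * z) hv
    simp only [mul_add, mul_inv_cancel_left₀ hcC] at h2
    push_cast
    linear_combination h2
  obtain ⟨hWu, hk⟩ := eq_resolvent_of_weak hK hweak
  set k : L2 m := ((1 + c * lam : ℝ) : ℂ) • u - hWu.toLp _ with hkdef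
  refine ⟨k, hk, (((2 * Real.pi) ^ 2 : ℝ) : ℂ) • (u - k), ?_, ?_⟩
  · have h := laplacian_resolvent k
    rwa [← hk] at h
  · filter_upwards [Lp.coeFn_smul (((2 * Real.pi) ^ 2 : ℝ) : ℂ) (u - k), Lp.coeFn_sub u k,
      Lp.coeFn_sub (((1 + c * lam : ℝ) : ℂ) • u) (hWu.toLp _),
      Lp.coeFn_smul ((1 + c * lam : ℝ) : ℂ) u, hWu.coeFn_toLp] with x h1 h2 h3 h4 h5
    rw [h1, Pi.smul_apply, h2, Pi.sub_apply, hkdef, h3, Pi.sub_apply, h4, Pi.smul_apply, h5,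
      Complex.coe_smul, Complex.coe_smul, hW]
    have hcc : (2 * Real.pi) ^ 2 * c = 1 := by
      have := Real.pi_pos
      rw [hc]
      exact mul_inv_cancel₀ (by positivity)
    have hvec : u x - ((1 + c * lam) • u x - (c * (V x + gravPotential u x)) • u x) =
        (c * (V x + gravPotential u x - lam)) • u x := by module
    simp only
    rw [hvec, smul_smul, ← mul_assoc, hcc, one_mul]

/-- Being in the range of the resolvent, `u` is bounded, which controls `U_u` at every point. That
Vu is in L² is then read off from the equation. -/
theorem IsWeakSolution.isStrongSolution {m : ℕ} {V : Space → ℝ} (hV : IsAdmissiblePotential V)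
    {lam : ℝ} {u : L2 m} (hu : IsWeakSolution V lam u) : IsStrongSolution V lam u := by
  obtain ⟨k, hk, Lu, hLu, hae⟩ := hu.exists_resolvent hV
  obtain ⟨C, -, hb⟩ := exists_resolvent_bound m
  have hB : ∀ᵐ x, ‖u x‖ ≤ C * ‖k‖ := by
    have := hb k
    rwa [← hk] at this
  obtain ⟨hint, M, hM⟩ := gravPotential_bounded u hB
  have hUu : MemLp (fun x => gravPotential u x • u x) 2 volume :=
    memLp_smul_of_bound (aestronglyMeasurable_gravPotential u) (Eventually.of_forall hM) u
  refine ⟨?_, hint, ?_, hUu, Lu, hLu, ?_⟩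
  · rw [hk]
    exact memH_resolvent k
  · refine (((Lp.memLp Lu).sub hUu).add ((Lp.memLp u).const_smul lam)).ae_eq ?_
    filter_upwards [hae] with x hx
    simp only [Pi.add_apply, Pi.sub_apply, Pi.smul_apply, hx]
    module
  · filter_upwards [hae] with x hx
    rw [hx]
    module

end SchrodingerPoisson

/-! ### Classical Laplacian, Green's identity and the regularized Newtonian kernel -/

namespace SchrodingerPoisson

open scoped ContDiff

theorem two_le_smooth : (2 : WithTop ℕ∞) ≤ ∞ :=
  WithTop.coe_le_coe.2 (le_top : (2 : ℕ∞) ≤ ⊤)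

section Laplacian

variable {F : Type*} [NormedAddCommGroup F] [NormedSpace ℝ F]

theorem laplacian_eq_sum_fderiv {f : Space → F} {x : Space} (hf : ContDiffAt ℝ 2 f x) :
    Δ f x = ∑ i, fderiv ℝ (fun y => fderiv ℝ f y (e i)) x (e i) := by
  rw [InnerProductSpace.laplacian_eq_iteratedFDeriv_orthonormalBasis f
    (EuclideanSpace.basisFun (Fin 3) ℝ)]
  refine Finset.sum_congr rfl fun i _ => ?_
  rw [iteratedFDeriv_two_apply]
  have hd : DifferentiableAt ℝ (fderiv ℝ f) x :=
    (hf.fderiv_right (m := 1) (by norm_num)).differentiableAt one_ne_zero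
  rw [fderiv_clm_apply hd (differentiableAt_const _)]
  simp [e]

theorem _root_.ContDiff.laplacian {f : Space → F} (hf : ContDiff ℝ ∞ f) :
    ContDiff ℝ ∞ (Δ f) := by
  have h2 : ContDiff ℝ 2 f := hf.of_le two_le_smooth
  have : Δ f = fun x => ∑ i, fderiv ℝ (fun y => fderiv ℝ f y (e i)) x (e i) :=
    funext fun x => laplacian_eq_sum_fderiv h2.contDiffAt
  rw [this]
  refine ContDiff.sum fun i _ => ?_
  have h1 : ContDiff ℝ ∞ (fun y => fderiv ℝ f y (e i)) :=
    (hf.fderiv_right (m := ∞) le_rfl).clm_apply contDiff_const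
  exact (h1.fderiv_right (m := ∞) le_rfl).clm_apply contDiff_const

theorem fderiv_comp_const_sub_apply {g : Space → F} (hg : Differentiable ℝ g) (a x v : Space) :
    fderiv ℝ (fun t => g (a - t)) x v = -fderiv ℝ g (a - x) v := by
  have h : HasFDerivAt (fun t => g (a - t)) _ x :=
    (hg (a - x)).hasFDerivAt.comp x ((hasFDerivAt_id x).const_sub a)
  rw [h.fderiv]
  simp

theorem laplacian_comp_const_sub {f : Space → F} (hf : ContDiff ℝ 2 f) (a x : Space) :
    Δ (fun t => f (a - t)) x = Δ f (a - x) := by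
  have hg : ContDiff ℝ 2 fun t => f (a - t) := hf.comp (contDiff_const.sub contDiff_id)
  have hd : ∀ i, Differentiable ℝ fun y => fderiv ℝ f y (e i) := fun i =>
    ((hf.fderiv_right (m := 1) (by norm_num)).clm_apply contDiff_const).differentiable one_ne_zero
  rw [laplacian_eq_sum_fderiv hg.contDiffAt, laplacian_eq_sum_fderiv hf.contDiffAt]
  refine Finset.sum_congr rfl fun i _ => ?_
  simp only [fderiv_comp_const_sub_apply (hf.differentiable two_ne_zero)]
  rw [fderiv_fun_neg, _root_.neg_apply, fderiv_comp_const_sub_apply (hd i), neg_neg]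

theorem hasCompactSupport_laplacian {f : Space → F} (hc : HasCompactSupport f) :
    HasCompactSupport (Δ f) := by
  refine hc.mono' ?_
  intro x hx
  by_contra hxf
  apply hx
  have h0 : f =ᶠ[𝓝 x] fun _ => 0 := notMem_tsupport_iff_eventuallyEq.1 hxf
  have := (InnerProductSpace.laplacian_congr_nhds h0).eq_of_nhds
  rw [this, InnerProductSpace.laplacian_const]
  rfl

/-- Green's identity with a compactly supported scalar function. -/
theorem integral_laplacian_smul_eq {A : Space → F} (hA : ContDiff ℝ 2 A) {φ : Space → ℝ}
    (hφ : ContDiff ℝ 2 φ) (hc : HasCompactSupport φ) :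
    ∫ x, Δ φ x • A x = ∫ x, φ x • Δ A x := by
  have hφ1 : ∀ i, ContDiff ℝ 1 fun y => fderiv ℝ φ y (e i) := fun i =>
    (hφ.fderiv_right (m := 1) (by norm_num)).clm_apply contDiff_const
  have hA1 : ∀ i, ContDiff ℝ 1 fun y => fderiv ℝ A y (e i) := fun i =>
    (hA.fderiv_right (m := 1) (by norm_num)).clm_apply contDiff_const
  have hφ2 : ∀ i, Continuous fun y => fderiv ℝ (fun y => fderiv ℝ φ y (e i)) y (e i) := fun i =>
    ((hφ1 i).continuous_fderiv one_ne_zero).clm_apply continuous_const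
  have hA2 : ∀ i, Continuous fun y => fderiv ℝ (fun y => fderiv ℝ A y (e i)) y (e i) := fun i =>
    ((hA1 i).continuous_fderiv one_ne_zero).clm_apply continuous_const
  have hc1 : ∀ i, HasCompactSupport fun y => fderiv ℝ φ y (e i) := fun i =>
    hc.fderiv_apply (𝕜 := ℝ) (e i)
  have hc2 : ∀ i, HasCompactSupport fun y => fderiv ℝ (fun y => fderiv ℝ φ y (e i)) y (e i) :=
    fun i => (hc1 i).fderiv_apply (𝕜 := ℝ) (e i)
  have hint : ∀ {g : Space → ℝ} {B : Space → F}, Continuous g → HasCompactSupport g →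
      Continuous B → Integrable fun x => g x • B x := fun hg hgc hB =>
    (hg.smul hB).integrable_of_hasCompactSupport hgc.smul_right
  simp only [laplacian_eq_sum_fderiv hφ.contDiffAt, laplacian_eq_sum_fderiv hA.contDiffAt,
    Finset.sum_smul, Finset.smul_sum]
  rw [integral_finsetSum _ fun i _ => hint (hφ2 i) (hc2 i) hA.continuous,
    integral_finsetSum _ fun i _ => hint hφ.continuous hc (hA2 i)]
  refine Finset.sum_congr rfl fun i _ => ?_
  rw [integral_smul_fderiv_eq_neg_fderiv_smul_of_integrable
    (hint (hφ1 i).continuous (hc1 i) (hA1 i).continuous) (hint hφ.continuous hc (hA2 i))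
    (hint hφ.continuous hc (hA1 i).continuous)
    (fun x _ => (hφ.differentiable two_ne_zero) x)
    (fun x _ => ((hA1 i).differentiable one_ne_zero) x),
    integral_smul_fderiv_eq_neg_fderiv_smul_of_integrable
    (hint (hφ2 i) (hc2 i) hA.continuous) (hint (hφ1 i).continuous (hc1 i) (hA1 i).continuous)
    (hint (hφ1 i).continuous (hc1 i) hA.continuous)
    (fun x _ => ((hφ1 i).differentiable one_ne_zero) x)
    (fun x _ => (hA.differentiable two_ne_zero) x), neg_neg]

end Laplacian

/-- The regularized Newtonian kernel `(|x|² + ε²)^(-1/2)`. -/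
noncomputable def newtonKernel (ε : ℝ) (x : Space) : ℝ := (‖x‖ ^ 2 + ε ^ 2) ^ (-1 / 2 : ℝ)

theorem newtonKernel_zero (x : Space) : newtonKernel 0 x = ‖x‖⁻¹ := by
  rw [newtonKernel, show ‖x‖ ^ 2 + (0 : ℝ) ^ 2 = ‖x‖ ^ (2 : ℝ) by norm_num,
    ← Real.rpow_mul (norm_nonneg _)]
  norm_num [Real.rpow_neg_one]

theorem newtonKernel_nonneg (ε : ℝ) (x : Space) : 0 ≤ newtonKernel ε x := by
  unfold newtonKernel
  positivity

/-- The origin must be excluded, because the inverse of 0 is 0 there. -/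
theorem newtonKernel_le {x : Space} (hx : x ≠ 0) (ε : ℝ) : newtonKernel ε x ≤ ‖x‖⁻¹ := by
  rw [← newtonKernel_zero, newtonKernel, newtonKernel]
  have : 0 < ‖x‖ := norm_pos_iff.2 hx
  exact Real.rpow_le_rpow_of_nonpos (by positivity) (by nlinarith [sq_nonneg ε]) (by norm_num)

theorem contDiffAt_norm_sq_add_rpow {ε : ℝ} {x : Space} (h : 0 < ‖x‖ ^ 2 + ε ^ 2) (p : ℝ) :
    ContDiffAt ℝ ∞ (fun y : Space => (‖y‖ ^ 2 + ε ^ 2) ^ p) x :=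
  ((contDiff_norm_sq ℝ).contDiffAt.add contDiffAt_const).rpow_const_of_ne h.ne'

theorem hasFDerivAt_norm_sq_add_rpow {ε : ℝ} {x : Space} (h : 0 < ‖x‖ ^ 2 + ε ^ 2) (p : ℝ) :
    HasFDerivAt (fun y : Space => (‖y‖ ^ 2 + ε ^ 2) ^ p)
      ((2 * p * (‖x‖ ^ 2 + ε ^ 2) ^ (p - 1)) • innerSL ℝ x) x := by
  have h1 : HasFDerivAt (fun y : Space => ‖y‖ ^ 2 + ε ^ 2) (2 • innerSL ℝ x) x :=
    (hasStrictFDerivAt_norm_sq x).hasFDerivAt.add_const _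
  refine (h1.rpow_const (p := p) (Or.inl h.ne')).congr_fderiv ?_
  rw [two_nsmul, ← two_smul ℝ, smul_smul]
  congr 1
  ring

/-- The hypothesis covers two uses: all points when ε ≠ 0, and harmonicity of 1/|x| away from the
origin when ε = 0. -/
theorem laplacian_newtonKernel {ε : ℝ} {x : Space} (h : 0 < ‖x‖ ^ 2 + ε ^ 2) :
    Δ (newtonKernel ε) x = -(3 * ε ^ 2 * (‖x‖ ^ 2 + ε ^ 2) ^ (-5 / 2 : ℝ)) := by
  have hev : ∀ᶠ y in 𝓝 x, 0 < ‖y‖ ^ 2 + ε ^ 2 :=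
    ((continuous_norm.pow 2).add continuous_const).continuousAt.eventually (lt_mem_nhds h)
  have hN : ContDiffAt ℝ 2 (newtonKernel ε) x :=
    (contDiffAt_norm_sq_add_rpow h _).of_le two_le_smooth
  rw [laplacian_eq_sum_fderiv hN]
  have hi : ∀ i, fderiv ℝ (fun y => fderiv ℝ (newtonKernel ε) y (e i)) x (e i) =
      -(‖x‖ ^ 2 + ε ^ 2) ^ (-3 / 2 : ℝ) +
        3 * (‖x‖ ^ 2 + ε ^ 2) ^ (-5 / 2 : ℝ) * inner ℝ x (e i) ^ 2 := by
    intro i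
    have h1 : (fun y => fderiv ℝ (newtonKernel ε) y (e i)) =ᶠ[𝓝 x]
        fun y => -(‖y‖ ^ 2 + ε ^ 2) ^ (-3 / 2 : ℝ) * inner ℝ y (e i) := by
      filter_upwards [hev] with y hy
      have := (hasFDerivAt_norm_sq_add_rpow hy (-1 / 2)).fderiv
      rw [show newtonKernel ε = fun y : Space => (‖y‖ ^ 2 + ε ^ 2) ^ (-1 / 2 : ℝ) from rfl, this]
      simp only [_root_.smul_apply, innerSL_apply_apply, smul_eq_mul]
      norm_num
    have h2 : HasFDerivAt (fun y : Space => (inner ℝ y (e i) : ℝ)) (innerSL ℝ (e i)) x := by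
      have := (innerSL ℝ (e i)).hasFDerivAt (x := x)
      refine this.congr_of_eventuallyEq (Eventually.of_forall fun y => ?_)
      exact real_inner_comm _ _
    have h3 : HasFDerivAt (fun y : Space => -(‖y‖ ^ 2 + ε ^ 2) ^ (-3 / 2 : ℝ) * inner ℝ y (e i)) _
        x := (hasFDerivAt_norm_sq_add_rpow h (-3 / 2)).neg.mul h2
    rw [h1.fderiv_eq, h3.fderiv]
    have hee : inner ℝ (e i) (e i) = (1 : ℝ) := by simp [e]
    simp only [_root_.add_apply, _root_.smul_apply, _root_.neg_apply, innerSL_apply_apply,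
      smul_eq_mul, hee]
    norm_num
    ring
  simp only [hi]
  rw [Finset.sum_add_distrib, ← Finset.mul_sum, sum_coord_sq]
  have h4 : (‖x‖ ^ 2 + ε ^ 2) ^ (-3 / 2 : ℝ) =
      (‖x‖ ^ 2 + ε ^ 2) ^ (-5 / 2 : ℝ) * (‖x‖ ^ 2 + ε ^ 2) := by
    rw [← Real.rpow_add_one h.ne']
    norm_num
  rw [h4]
  simp
  ring

end SchrodingerPoisson

/-! ### The fundamental solution and the parametrix identity -/

namespace SchrodingerPoisson

open scoped ContDiff Convolution

theorem contDiff_newtonKernel {ε : ℝ} (hε : 0 < ε) : ContDiff ℝ ∞ (newtonKernel ε) :=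
  contDiff_iff_contDiffAt.2 fun x => contDiffAt_norm_sq_add_rpow (by positivity) _

theorem measurable_newtonKernel (ε : ℝ) : Measurable (newtonKernel ε) :=
  ((measurable_norm.pow_const 2).add_const _).pow_const _

theorem locallyIntegrable_newtonKernel_zero : LocallyIntegrable (newtonKernel 0) volume := by
  refine locallyIntegrable_of_norm_le_rpow (C := 1) (α := 1) (by simp) (by simp)
    (Eventually.of_forall fun x => ?_) (measurable_newtonKernel 0).aestronglyMeasurable
  rw [newtonKernel_zero, one_mul, Real.rpow_neg_one, norm_inv, norm_norm]

/-- The profile `3 (1 + |x|²)^(-5/2)` of the Laplacian of the regularized Newtonian kernel. -/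
noncomputable def newtonProfile (x : Space) : ℝ := 3 * (1 + ‖x‖ ^ 2) ^ (-5 / 2 : ℝ)

theorem newtonProfile_pos (x : Space) : 0 < newtonProfile x := by
  unfold newtonProfile
  positivity

theorem integrable_newtonProfile : Integrable newtonProfile :=
  (integrable_rpow_neg_one_add_norm_sq (E := Space) (μ := volume) (r := 5)
    (by simp; norm_num)).const_mul 3

/-- The total mass of `newtonProfile`. -/
noncomputable def newtonMass : ℝ := ∫ x, newtonProfile x

/-- Positivity is all that is needed of this constant: its value only enters as a factor in the
Poisson equation, which does not affect smoothness. -/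
theorem newtonMass_pos : 0 < newtonMass := by
  rw [newtonMass, integral_pos_iff_support_of_nonneg (fun x => (newtonProfile_pos x).le)
    integrable_newtonProfile]
  have : Function.support newtonProfile = Set.univ :=
    Set.eq_univ_of_forall fun x => (newtonProfile_pos x).ne'
  rw [this]
  simp

/-- The decay condition under which rescalings of the profile form an approximate identity acting on
functions that are integrable and continuous at 0. -/
theorem tendsto_norm_pow_mul_newtonProfile :
    Tendsto (fun x : Space => ‖x‖ ^ 3 * newtonProfile x) (Bornology.cobounded Space) (𝓝 0) := by
  have h : Tendsto (fun x : Space => 3 * ‖x‖⁻¹) (Bornology.cobounded Space) (𝓝 0) := by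
    have := (tendsto_inv_atTop_zero.comp (tendsto_norm_cobounded_atTop (E := Space))).const_mul 3
    simpa using this
  refine squeeze_zero (fun x => mul_nonneg (by positivity) (newtonProfile_pos x).le)
    (fun x => ?_) h
  rcases eq_or_ne x 0 with rfl | hx
  · simp
  have hx' : 0 < ‖x‖ := norm_pos_iff.2 hx
  have h1 : (1 + ‖x‖ ^ 2) ^ (-5 / 2 : ℝ) ≤ (‖x‖ ^ 4)⁻¹ := by
    calc (1 + ‖x‖ ^ 2) ^ (-5 / 2 : ℝ) ≤ (1 + ‖x‖ ^ 2) ^ (-(2 : ℕ) : ℝ) :=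
          Real.rpow_le_rpow_of_exponent_le (by nlinarith) (by norm_num)
      _ = ((1 + ‖x‖ ^ 2) ^ 2)⁻¹ := by rw [Real.rpow_neg (by positivity), Real.rpow_natCast]
      _ ≤ (‖x‖ ^ 4)⁻¹ := by
          apply inv_anti₀ (by positivity)
          nlinarith [sq_nonneg ‖x‖]
  rw [newtonProfile]
  calc ‖x‖ ^ 3 * (3 * (1 + ‖x‖ ^ 2) ^ (-5 / 2 : ℝ)) ≤ ‖x‖ ^ 3 * (3 * (‖x‖ ^ 4)⁻¹) := by gcongr
    _ = 3 * ‖x‖⁻¹ := by field_simp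

theorem laplacian_newtonKernel_inv {c : ℝ} (hc : 0 < c) (x : Space) :
    Δ (newtonKernel c⁻¹) x = -(c ^ 3 * newtonProfile (c • x)) := by
  have hq : 0 < ‖x‖ ^ 2 + (c⁻¹) ^ 2 := by positivity
  rw [laplacian_newtonKernel hq, newtonProfile, norm_smul, Real.norm_of_nonneg hc.le]
  have h1 : 1 + (c * ‖x‖) ^ 2 = c ^ (2 : ℝ) * (‖x‖ ^ 2 + (c⁻¹) ^ 2) := by
    rw [Real.rpow_two]
    field_simp
    ring
  have h2 : (c ^ (2 : ℝ)) ^ (-5 / 2 : ℝ) = (c ^ 5)⁻¹ := by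
    rw [← Real.rpow_mul hc.le, show (2 * (-5 / 2) : ℝ) = -(5 : ℕ) by norm_num,
      Real.rpow_neg hc.le, Real.rpow_natCast]
  rw [h1, Real.mul_rpow (by positivity) hq.le, h2]
  field_simp

/-- Regularize with ε = 1/(n + 1). By dominated convergence the integrals tend to the left side; by
Green's identity they equal integrals of φ against minus a rescaled profile, which concentrates at
0. -/
theorem integral_newtonKernel_mul_laplacian {φ : Space → ℝ} (hφ : ContDiff ℝ ∞ φ)
    (hc : HasCompactSupport φ) :
    ∫ t, newtonKernel 0 t * Δ φ t = -(newtonMass * φ 0) := by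
  have hφ2 : ContDiff ℝ 2 φ := hφ.of_le two_le_smooth
  have hLc : HasCompactSupport (Δ φ) := hasCompactSupport_laplacian hc
  have hcn : ∀ n : ℕ, (0 : ℝ) < n + 1 := fun n => by positivity
  have hlhs : Tendsto (fun n : ℕ => ∫ t, Δ φ t * newtonKernel ((n + 1 : ℝ)⁻¹) t) atTop
      (𝓝 (∫ t, Δ φ t * newtonKernel 0 t)) := by
    refine tendsto_integral_of_dominated_convergence (fun t => ‖Δ φ t‖ * newtonKernel 0 t)
      (fun n => ?_) ?_ (fun n => ?_) ?_
    · exact hφ.laplacian.continuous.aestronglyMeasurable.mul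
        (measurable_newtonKernel _).aestronglyMeasurable
    · exact locallyIntegrable_newtonKernel_zero.integrable_smul_left_of_hasCompactSupport
        hφ.laplacian.continuous.norm hLc.norm
    · filter_upwards [Measure.ae_ne volume (0 : Space)] with x hx
      rw [norm_mul, Real.norm_of_nonneg (newtonKernel_nonneg _ _), newtonKernel_zero]
      gcongr
      exact newtonKernel_le hx _
    · filter_upwards [Measure.ae_ne volume (0 : Space)] with x hx
      refine Tendsto.const_mul _ ?_
      have hx' : 0 < ‖x‖ := norm_pos_iff.2 hx
      have h0 : Tendsto (fun n : ℕ => (n + 1 : ℝ)⁻¹) atTop (𝓝 0) := by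
        simpa using tendsto_one_div_add_atTop_nhds_zero_nat (𝕜 := ℝ)
      exact ((h0.pow 2).const_add _).rpow_const (Or.inl (by positivity))
  have hrhs : Tendsto (fun n : ℕ => ∫ t, Δ φ t * newtonKernel ((n + 1 : ℝ)⁻¹) t) atTop
      (𝓝 (-(newtonMass * φ 0))) := by
    have hpk := tendsto_integral_comp_smul_smul_of_integrable (μ := (volume : Measure Space))
      (φ := fun x => newtonMass⁻¹ * newtonProfile x)
      (fun x => mul_nonneg (inv_nonneg.2 newtonMass_pos.le) (newtonProfile_pos x).le)
      (by rw [integral_const_mul, ← newtonMass, inv_mul_cancel₀ newtonMass_pos.ne'])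
      (by
        have := tendsto_norm_pow_mul_newtonProfile.const_mul newtonMass⁻¹
        rw [mul_zero] at this
        refine this.congr fun x => ?_
        simp only [finrank_euclideanSpace, Fintype.card_fin]
        ring)
      (hφ.continuous.integrable_of_hasCompactSupport hc) hφ.continuous.continuousAt
    have hpk2 := (hpk.comp ((tendsto_natCast_atTop_atTop (R := ℝ)).atTop_add
      (tendsto_const_nhds (x := (1 : ℝ))))).const_mul (-newtonMass)
    rw [neg_mul] at hpk2
    refine hpk2.congr fun n => ?_
    have hgreen := integral_laplacian_smul_eq
      ((contDiff_newtonKernel (inv_pos.2 (hcn n))).of_le two_le_smooth) hφ2 hc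
    simp only [smul_eq_mul] at hgreen
    rw [hgreen, Function.comp_apply, ← integral_const_mul]
    refine integral_congr_ae (Eventually.of_forall fun t => ?_)
    simp only [finrank_euclideanSpace, Fintype.card_fin, smul_eq_mul]
    rw [laplacian_newtonKernel_inv (hcn n)]
    have := newtonMass_pos.ne'
    field_simp
  have h := tendsto_nhds_unique hlhs hrhs
  rw [← h]
  simp only [mul_comm]

/-- The cut-off function of the parametrix. -/
noncomputable def cutoff : ContDiffBump (0 : Space) := ⟨1, 2, one_pos, one_lt_two⟩

/-- The regularized Newtonian kernel, cut off outside a ball. -/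
noncomputable def cutKernel (ε : ℝ) (x : Space) : ℝ := cutoff x * newtonKernel ε x

/-- The smooth part of the Newtonian kernel. -/
noncomputable def farKernel (x : Space) : ℝ := (1 - cutoff x) * newtonKernel 0 x

theorem contDiff_farKernel : ContDiff ℝ ∞ farKernel := by
  rw [contDiff_iff_contDiffAt]
  intro x
  rcases eq_or_ne x 0 with rfl | hx
  · have h : farKernel =ᶠ[𝓝 0] fun _ => 0 := by
      filter_upwards [cutoff.eventuallyEq_one] with y hy
      rw [farKernel, hy]
      simp
    exact contDiffAt_const.congr_of_eventuallyEq h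
  · have : 0 < ‖x‖ := norm_pos_iff.2 hx
    exact (contDiffAt_const.sub cutoff.contDiff.contDiffAt).mul
      (contDiffAt_norm_sq_add_rpow (by positivity) _)

/-- Outside the ball of radius 2 the cut-off vanishes and the kernel is 1/|x|, which is harmonic
there. -/
theorem hasCompactSupport_laplacian_farKernel : HasCompactSupport (Δ farKernel) := by
  refine HasCompactSupport.intro (isCompact_closedBall (0 : Space) 2) fun x hx => ?_
  have hx2 : 2 < ‖x‖ := by simpa using hx
  have h : farKernel =ᶠ[𝓝 x] newtonKernel 0 := by
    filter_upwards [continuous_norm.continuousAt.eventually (lt_mem_nhds hx2)] with y hy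
    rw [farKernel, cutoff.zero_of_le_dist, sub_zero, one_mul]
    rw [dist_zero_right]
    exact hy.le
  rw [(InnerProductSpace.laplacian_congr_nhds h).eq_of_nhds, laplacian_newtonKernel (by positivity)]
  norm_num

theorem hasCompactSupport_cutKernel (ε : ℝ) : HasCompactSupport (cutKernel ε) :=
  cutoff.hasCompactSupport.mul_right

theorem integrable_cutKernel_zero : Integrable (cutKernel 0) :=
  locallyIntegrable_newtonKernel_zero.integrable_smul_left_of_hasCompactSupport
    cutoff.continuous cutoff.hasCompactSupport

theorem cutKernel_neg (ε : ℝ) (x : Space) : cutKernel ε (-x) = cutKernel ε x := by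
  rw [cutKernel, cutKernel, cutoff.neg, newtonKernel, newtonKernel, norm_neg]

/-- The parametrix identity for test functions. -/
theorem cutKernel_convolution_laplacian {φ : Space → ℝ} (hφ : ContDiff ℝ ∞ φ)
    (hc : HasCompactSupport φ) (x : Space) :
    (cutKernel 0 ⋆[ContinuousLinearMap.lsmul ℝ ℝ, volume] Δ φ) x =
      -(newtonMass * φ x) -
        (Δ farKernel ⋆[ContinuousLinearMap.lsmul ℝ ℝ, volume] φ) x := by
  have hφx : ContDiff ℝ ∞ fun t => φ (x - t) := hφ.comp (contDiff_const.sub contDiff_id)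
  have hcx : HasCompactSupport fun t => φ (x - t) := hc.comp_homeomorph (Homeomorph.subLeft x)
  have hLc := hasCompactSupport_laplacian hcx
  have h1 := integral_newtonKernel_mul_laplacian hφx hcx
  have h2 := integral_laplacian_smul_eq (contDiff_farKernel.of_le two_le_smooth)
    (hφx.of_le two_le_smooth) hcx
  simp only [smul_eq_mul] at h2
  rw [sub_zero] at h1
  rw [convolution_def, convolution_def]
  simp only [ContinuousLinearMap.lsmul_apply, smul_eq_mul]
  rw [← h1]
  -- The Laplacian moves onto the far kernel, the smooth one, so the two pieces of 1/|x| recombine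
  -- under one integral.
  have h3 : ∫ t, Δ farKernel t * φ (x - t) = ∫ t, farKernel t * Δ (fun t => φ (x - t)) t := by
    simp only [mul_comm (Δ farKernel _), ← h2, mul_comm (farKernel _)]
  rw [h3, ← integral_sub]
  · refine integral_congr_ae (Eventually.of_forall fun t => ?_)
    simp only
    rw [laplacian_comp_const_sub (hφ.of_le two_le_smooth), cutKernel, farKernel]
    ring
  · have := locallyIntegrable_newtonKernel_zero.integrable_smul_left_of_hasCompactSupport
      hφx.laplacian.continuous hLc
    simpa only [smul_eq_mul, mul_comm] using this
  · exact (contDiff_farKernel.continuous.mul hφx.laplacian.continuous).integrable_of_hasCompactSupport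
      hLc.mul_left

end SchrodingerPoisson

/-! ### Convolutions with bounded functions and representation by the parametrix -/

namespace SchrodingerPoisson

open scoped ContDiff Convolution
open ContinuousLinearMap (lsmul)

theorem fderiv_convolution_right_apply {k φ : Space → ℝ} (hk : LocallyIntegrable k volume)
    (hφ : ContDiff ℝ 1 φ) (hc : HasCompactSupport φ) (x v : Space) :
    fderiv ℝ (k ⋆[lsmul ℝ ℝ, volume] φ) x v =
      (k ⋆[lsmul ℝ ℝ, volume] fun y => fderiv ℝ φ y v) x := by
  rw [(hc.hasFDerivAt_convolution_right (lsmul ℝ ℝ) hk hφ x).fderiv]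
  exact convolution_precompR_apply (lsmul ℝ ℝ) hk (hc.fderiv ℝ)
    (hφ.continuous_fderiv one_ne_zero) x v

theorem laplacian_convolution {k φ : Space → ℝ} (hk : LocallyIntegrable k volume)
    (hφ : ContDiff ℝ ∞ φ) (hc : HasCompactSupport φ) :
    Δ (k ⋆[lsmul ℝ ℝ, volume] φ) = k ⋆[lsmul ℝ ℝ, volume] Δ φ := by
  have hφ1 : ∀ i, ContDiff ℝ ∞ fun y => fderiv ℝ φ y (e i) := fun i =>
    (hφ.fderiv_right (m := ∞) le_rfl).clm_apply contDiff_const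
  have hφ2 : ∀ i, Continuous fun y => fderiv ℝ (fun y => fderiv ℝ φ y (e i)) y (e i) := fun i =>
    ((hφ1 i).continuous_fderiv (by simp)).clm_apply continuous_const
  have hc1 : ∀ i, HasCompactSupport fun y => fderiv ℝ φ y (e i) := fun i =>
    hc.fderiv_apply (𝕜 := ℝ) (e i)
  have hc2 : ∀ i, HasCompactSupport fun y => fderiv ℝ (fun y => fderiv ℝ φ y (e i)) y (e i) :=
    fun i => (hc1 i).fderiv_apply (𝕜 := ℝ) (e i)
  have hone : (1 : WithTop ℕ∞) ≤ ∞ := WithTop.coe_le_coe.2 (le_top : (1 : ℕ∞) ≤ ⊤)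
  have hconv : ContDiff ℝ ∞ (k ⋆[lsmul ℝ ℝ, volume] φ) :=
    hc.contDiff_convolution_right (lsmul ℝ ℝ) hk hφ
  ext x
  rw [laplacian_eq_sum_fderiv (hconv.of_le two_le_smooth).contDiffAt]
  have h1 : ∀ i, (fun y => fderiv ℝ (k ⋆[lsmul ℝ ℝ, volume] φ) y (e i)) =
      k ⋆[lsmul ℝ ℝ, volume] fun y => fderiv ℝ φ y (e i) := fun i =>
    funext fun y => fderiv_convolution_right_apply hk (hφ.of_le hone) hc y (e i)
  simp only [h1]
  simp only [fderiv_convolution_right_apply hk ((hφ1 _).of_le hone) (hc1 _)]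
  have h2 : Δ φ = fun y => ∑ i, fderiv ℝ (fun y => fderiv ℝ φ y (e i)) y (e i) :=
    funext fun y => laplacian_eq_sum_fderiv (hφ.of_le two_le_smooth).contDiffAt
  rw [h2]
  simp only [convolution_def, map_sum]
  rw [integral_finsetSum]
  intro i _
  exact ((hc2 i).convolutionExists_right (lsmul ℝ ℝ) hk (hφ2 i) x).integrable

section Bounded

variable {F : Type*} [NormedAddCommGroup F]
  {G : Type*} [NormedAddCommGroup G] [NormedSpace ℝ G]
  {H : Type*} [NormedAddCommGroup H] [NormedSpace ℝ H]

/-- Measurable and essentially bounded. -/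
def EssBounded (f : Space → F) : Prop :=
  AEStronglyMeasurable f volume ∧ ∃ M : ℝ, ∀ᵐ x, ‖f x‖ ≤ M

theorem EssBounded.locallyIntegrable {f : Space → F} (hf : EssBounded f) :
    LocallyIntegrable f volume := by
  obtain ⟨hm, M, hM⟩ := hf
  exact (memLp_top_of_bound hm M hM).locallyIntegrable le_top

variable [NormedSpace ℝ F]

theorem EssBounded.integrable_convolution {f : Space → F} (hf : EssBounded f) {k : Space → G}
    (hk : Integrable k) (L : G →L[ℝ] F →L[ℝ] H) (x : Space) :
    Integrable fun t => L (k t) (f (x - t)) := by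
  obtain ⟨hm, M, hM⟩ := hf
  have hq := quasiMeasurePreserving_sub_left_of_right_invariant (volume : Measure Space) x
  exact L.integrable_of_bilin_of_bdd_right M hk (hm.comp_quasiMeasurePreserving hq)
    (hq.ae hM)

/-- L¹ convergence of kernels thus gives uniform convergence of their convolutions with a bounded
function. -/
theorem norm_convolution_sub_le {f : Space → F} (hm : AEStronglyMeasurable f volume) {M : ℝ}
    (hM : ∀ᵐ x, ‖f x‖ ≤ M) {k k' : Space → G} (hk : Integrable k) (hk' : Integrable k')
    (L : G →L[ℝ] F →L[ℝ] H) (x : Space) :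
    ‖(k ⋆[L, volume] f) x - (k' ⋆[L, volume] f) x‖ ≤ ‖L‖ * M * ∫ t, ‖k t - k' t‖ := by
  have hf : EssBounded f := ⟨hm, M, hM⟩
  have hq := quasiMeasurePreserving_sub_left_of_right_invariant (volume : Measure Space) x
  rw [convolution_def, convolution_def, ← integral_sub (hf.integrable_convolution hk L x)
    (hf.integrable_convolution hk' L x), ← integral_const_mul]
  refine norm_integral_le_of_norm_le ((hk.sub hk').norm.const_mul _) ?_
  filter_upwards [hq.ae hM] with t ht
  rw [← _root_.sub_apply, ← map_sub]
  refine (L.le_opNorm₂ _ _).trans ?_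
  rw [mul_assoc, mul_assoc, mul_comm M]
  gcongr

theorem tendstoUniformly_convolution {f : Space → F} (hf : EssBounded f) {k : ℕ → Space → G}
    {k₀ : Space → G} (hk : ∀ n, Integrable (k n)) (hk₀ : Integrable k₀)
    (hlim : Tendsto (fun n => ∫ t, ‖k n t - k₀ t‖) atTop (𝓝 0)) (L : G →L[ℝ] F →L[ℝ] H) :
    TendstoUniformly (fun n => k n ⋆[L, volume] f) (k₀ ⋆[L, volume] f) atTop := by
  obtain ⟨hm, M, hM⟩ := hf
  rw [Metric.tendstoUniformly_iff]
  intro ε hε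
  have h0 := hlim.const_mul (‖L‖ * M)
  rw [mul_zero] at h0
  filter_upwards [h0.eventually_lt_const hε] with n hn x
  rw [dist_comm, dist_eq_norm]
  exact (norm_convolution_sub_le hm hM (hk n) hk₀ L x).trans_lt hn

theorem continuous_convolution_essBounded {f : Space → F} (hf : EssBounded f) {k : Space → ℝ}
    (hk : Continuous k) (hc : HasCompactSupport k) :
    Continuous (k ⋆[lsmul ℝ ℝ, volume] f) :=
  hc.continuous_convolution_left (lsmul ℝ ℝ) hk hf.locallyIntegrable

variable [CompleteSpace F]

/-- Fubini: convolution with an even kernel is its own transpose. -/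
theorem integral_convolution_smul {f : Space → F} (hf : EssBounded f) {k φ : Space → ℝ}
    (hk : Integrable k) (hkn : ∀ x, k (-x) = k x) (hφ : Integrable φ) :
    ∫ x, (k ⋆[lsmul ℝ ℝ, volume] φ) x • f x = ∫ y, φ y • (k ⋆[lsmul ℝ ℝ, volume] f) y := by
  obtain ⟨hm, M, hM⟩ := hf
  have h0 : Integrable (fun p : Space × Space => (φ p.2 * k (p.1 - p.2)) • f p.1)
      (volume.prod volume) := by
    have h1 := hφ.convolution_integrand (ContinuousLinearMap.mul ℝ ℝ) hk
    have hq : Measure.QuasiMeasurePreserving (Prod.fst : Space × Space → Space)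
        (volume.prod volume) volume := Measure.quasiMeasurePreserving_fst
    refine (lsmul ℝ ℝ : ℝ →L[ℝ] F →L[ℝ] F).integrable_of_bilin_of_bdd_right M h1
      (hm.comp_quasiMeasurePreserving hq) (hq.ae hM)
  have hl : ∀ x, (k ⋆[lsmul ℝ ℝ, volume] φ) x • f x = ∫ y, (φ y * k (x - y)) • f x := fun x => by
    rw [convolution_eq_swap, ← integral_smul_const]
    simp only [ContinuousLinearMap.lsmul_apply, smul_eq_mul, mul_comm]
  have hr : ∀ y, φ y • (k ⋆[lsmul ℝ ℝ, volume] f) y = ∫ x, (φ y * k (x - y)) • f x := fun y => by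
    rw [convolution_eq_swap, ← integral_smul]
    refine integral_congr_ae (Eventually.of_forall fun x => ?_)
    simp only [ContinuousLinearMap.lsmul_apply]
    rw [smul_smul, ← hkn (y - x), neg_sub]
  simp only [hl, hr]
  exact integral_integral_swap h0

theorem laplacian_farKernel_neg (x : Space) : Δ farKernel (-x) = Δ farKernel x := by
  have h := laplacian_comp_const_sub (contDiff_farKernel.of_le two_le_smooth) 0 x
  have h2 : (fun t => farKernel (0 - t)) = farKernel := by
    ext t
    rw [zero_sub, farKernel, farKernel, cutoff.neg, newtonKernel, newtonKernel, norm_neg]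
  rw [h2, zero_sub] at h
  exact h.symm

theorem integrable_laplacian_farKernel : Integrable (Δ farKernel) :=
  contDiff_farKernel.laplacian.continuous.integrable_of_hasCompactSupport
    hasCompactSupport_laplacian_farKernel

/-- The representation of a weak solution of `Δ u = f` by the parametrix. -/
noncomputable def parametrix (f u : Space → F) (x : Space) : F :=
  (-newtonMass⁻¹) • ((cutKernel 0 ⋆[lsmul ℝ ℝ, volume] f) x +
    (Δ farKernel ⋆[lsmul ℝ ℝ, volume] u) x)

/-- The weak equation is tested with `cutKernel 0` ∗ φ, which is smooth and compactly supported
because the kernel was cut off. Its Laplacian is given by the parametrix identity. -/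
theorem smul_integral_eq_of_weak_laplacian {f u : Space → F} (hf : EssBounded f)
    (hu : EssBounded u)
    (h : ∀ φ : Space → ℝ, ContDiff ℝ ∞ φ → HasCompactSupport φ →
      ∫ x, Δ φ x • u x = ∫ x, φ x • f x)
    {φ : Space → ℝ} (hφ : ContDiff ℝ ∞ φ) (hc : HasCompactSupport φ) :
    (-newtonMass) • (∫ x, φ x • u x) -
      ∫ x, φ x • (Δ farKernel ⋆[lsmul ℝ ℝ, volume] u) x =
      ∫ x, φ x • (cutKernel 0 ⋆[lsmul ℝ ℝ, volume] f) x := by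
  have hφi : Integrable φ := hφ.continuous.integrable_of_hasCompactSupport hc
  have hk := integrable_cutKernel_zero.locallyIntegrable
  have hΦ : ContDiff ℝ ∞ (cutKernel 0 ⋆[lsmul ℝ ℝ, volume] φ) :=
    hc.contDiff_convolution_right (lsmul ℝ ℝ) hk hφ
  have hΦc : HasCompactSupport (cutKernel 0 ⋆[lsmul ℝ ℝ, volume] φ) :=
    (hasCompactSupport_cutKernel 0).convolution (lsmul ℝ ℝ) hc
  have h1 := h _ hΦ hΦc
  rw [laplacian_convolution hk hφ hc, integral_convolution_smul hf integrable_cutKernel_zero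
    (cutKernel_neg 0) hφi] at h1
  rw [← h1, ← integral_convolution_smul hu integrable_laplacian_farKernel
    laplacian_farKernel_neg hφi, ← integral_smul]
  have hi1 : Integrable fun x => φ x • u x :=
    hu.locallyIntegrable.integrable_smul_left_of_hasCompactSupport hφ.continuous hc
  have hi2 : Integrable fun x => (Δ farKernel ⋆[lsmul ℝ ℝ, volume] φ) x • u x :=
    hu.locallyIntegrable.integrable_smul_left_of_hasCompactSupport
      (hc.continuous_convolution_right (lsmul ℝ ℝ)
        integrable_laplacian_farKernel.locallyIntegrable hφ.continuous)
      (hasCompactSupport_laplacian_farKernel.convolution (lsmul ℝ ℝ) hc)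
  have hi1' : Integrable fun x => -newtonMass • φ x • u x := hi1.smul (-newtonMass)
  rw [← integral_sub hi1' hi2]
  refine integral_congr_ae (Eventually.of_forall fun x => ?_)
  simp only
  rw [cutKernel_convolution_laplacian hφ hc x, sub_smul, smul_smul, neg_mul]

theorem ae_eq_parametrix {f u : Space → F} (hf : EssBounded f) (hu : EssBounded u)
    (hcont : Continuous (cutKernel 0 ⋆[lsmul ℝ ℝ, volume] f))
    (h : ∀ φ : Space → ℝ, ContDiff ℝ ∞ φ → HasCompactSupport φ →
      ∫ x, Δ φ x • u x = ∫ x, φ x • f x) :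
    u =ᵐ[volume] parametrix f u := by
  have hψ := continuous_convolution_essBounded hu contDiff_farKernel.laplacian.continuous
    hasCompactSupport_laplacian_farKernel
  have hpc : Continuous (parametrix f u) := (hcont.add hψ).const_smul _
  refine ae_eq_of_integral_contDiff_smul_eq hu.locallyIntegrable
    hpc.locallyIntegrable fun φ hφ hc => ?_
  have h1 := smul_integral_eq_of_weak_laplacian hf hu h hφ hc
  have h3 : ∫ x, φ x • parametrix f u x = (-newtonMass⁻¹) •
      ((∫ x, φ x • (cutKernel 0 ⋆[lsmul ℝ ℝ, volume] f) x) +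
        ∫ x, φ x • (Δ farKernel ⋆[lsmul ℝ ℝ, volume] u) x) := by
    rw [← integral_add
      (hcont.locallyIntegrable.integrable_smul_left_of_hasCompactSupport hφ.continuous hc)
      (hψ.locallyIntegrable.integrable_smul_left_of_hasCompactSupport hφ.continuous hc),
      ← integral_smul]
    refine integral_congr_ae (Eventually.of_forall fun x => ?_)
    simp only [parametrix]
    rw [smul_comm, smul_add (φ x)]
  rw [h3, ← h1, sub_add_cancel, smul_smul, neg_mul_neg, inv_mul_cancel₀ newtonMass_pos.ne',
    one_smul]

end Bounded

end SchrodingerPoisson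

/-! ### Gain of one derivative by the parametrix -/

namespace SchrodingerPoisson

open scoped ContDiff Convolution
open ContinuousLinearMap (lsmul)

section Limits

variable {G : Type*} [NormedAddCommGroup G]

theorem tendsto_integral_norm_sub_of_dominated {k : ℕ → Space → G} {k₀ : Space → G}
    {g : Space → ℝ} (hm : ∀ n, AEStronglyMeasurable (k n) volume)
    (hm₀ : AEStronglyMeasurable k₀ volume) (hg : Integrable g)
    (hk : ∀ n, ∀ᵐ x, ‖k n x‖ ≤ g x) (hk₀ : ∀ᵐ x, ‖k₀ x‖ ≤ g x)
    (hlim : ∀ᵐ x, Tendsto (fun n => k n x) atTop (𝓝 (k₀ x))) :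
    Tendsto (fun n => ∫ x, ‖k n x - k₀ x‖) atTop (𝓝 0) := by
  have h := tendsto_integral_of_dominated_convergence (F := fun n x => ‖k n x - k₀ x‖)
    (f := fun _ => (0 : ℝ)) (fun x => g x + g x) (fun n => ((hm n).sub hm₀).norm) (hg.add hg)
    (fun n => by
      filter_upwards [hk n, hk₀] with x h1 h2
      rw [norm_norm]
      exact (norm_sub_le _ _).trans (add_le_add h1 h2))
    (by
      filter_upwards [hlim] with x hx
      have := (hx.sub_const (k₀ x)).norm
      rwa [sub_self, norm_zero] at this)
  simpa using h

end Limits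

/-- The derivative of the regularized cut-off Newtonian kernel. -/
noncomputable def gradCutKernel (ε : ℝ) (x : Space) : Space →L[ℝ] ℝ :=
  cutoff x • (-(‖x‖ ^ 2 + ε ^ 2) ^ (-3 / 2 : ℝ)) • innerSL ℝ x +
    newtonKernel ε x • fderiv ℝ cutoff x

theorem contDiff_cutKernel {ε : ℝ} (hε : 0 < ε) : ContDiff ℝ ∞ (cutKernel ε) :=
  cutoff.contDiff.mul (contDiff_newtonKernel hε)

theorem one_le_smooth : (1 : WithTop ℕ∞) ≤ ∞ := WithTop.coe_le_coe.2 (le_top : (1 : ℕ∞) ≤ ⊤)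

theorem fderiv_cutKernel {ε : ℝ} (hε : 0 < ε) : fderiv ℝ (cutKernel ε) = gradCutKernel ε := by
  ext1 x
  have h1 : HasFDerivAt cutoff (fderiv ℝ cutoff x) x :=
    ((cutoff.contDiff (n := 1)).differentiable one_ne_zero x).hasFDerivAt
  have h2 := hasFDerivAt_norm_sq_add_rpow (ε := ε) (x := x) (by positivity) (-1 / 2)
  have h3 : HasFDerivAt (cutKernel ε) _ x := h1.mul h2
  rw [h3.fderiv, gradCutKernel, newtonKernel]
  norm_num

/-- The majorant does not depend on ε, and its singularity |x|⁻² is integrable in dimension three;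
dominated convergence as ε → 0 rests on this. -/
theorem norm_gradCutKernel_le {x : Space} (hx : x ≠ 0) (ε : ℝ) :
    ‖gradCutKernel ε x‖ ≤ cutoff x * ‖x‖ ^ (-2 : ℝ) + ‖fderiv ℝ cutoff x‖ * ‖x‖⁻¹ := by
  have hx' : 0 < ‖x‖ := norm_pos_iff.2 hx
  have h1 : (‖x‖ ^ 2 + ε ^ 2) ^ (-3 / 2 : ℝ) ≤ ‖x‖ ^ (-3 : ℝ) := by
    calc (‖x‖ ^ 2 + ε ^ 2) ^ (-3 / 2 : ℝ) ≤ (‖x‖ ^ 2) ^ (-3 / 2 : ℝ) :=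
          Real.rpow_le_rpow_of_nonpos (by positivity) (by nlinarith [sq_nonneg ε]) (by norm_num)
      _ = ‖x‖ ^ (-3 : ℝ) := by
          rw [← Real.rpow_two, ← Real.rpow_mul hx'.le]
          norm_num
  have h2 : ‖x‖ ^ (-3 : ℝ) * ‖x‖ = ‖x‖ ^ (-2 : ℝ) := by
    rw [← Real.rpow_add_one hx'.ne']
    norm_num
  refine (norm_add_le _ _).trans (add_le_add ?_ ?_)
  · rw [norm_smul, norm_smul, innerSL_apply_norm, norm_neg, Real.norm_of_nonneg cutoff.nonneg,
      Real.norm_of_nonneg (by positivity), ← h2]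
    have := cutoff.nonneg (x := x)
    gcongr
  · rw [norm_smul, Real.norm_of_nonneg (newtonKernel_nonneg _ _), mul_comm]
    gcongr
    exact newtonKernel_le hx ε

theorem norm_cutKernel_le {x : Space} (hx : x ≠ 0) (ε : ℝ) :
    ‖cutKernel ε x‖ ≤ cutKernel 0 x := by
  rw [cutKernel, cutKernel, norm_mul, Real.norm_of_nonneg cutoff.nonneg,
    Real.norm_of_nonneg (newtonKernel_nonneg _ _), newtonKernel_zero]
  exact mul_le_mul_of_nonneg_left (newtonKernel_le hx ε) cutoff.nonneg

theorem integrable_gradCutKernel_bound :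
    Integrable fun x => cutoff x * ‖x‖ ^ (-2 : ℝ) + ‖fderiv ℝ cutoff x‖ * ‖x‖⁻¹ := by
  have h2 : LocallyIntegrable (fun x : Space => ‖x‖ ^ (-2 : ℝ)) volume := by
    refine locallyIntegrable_of_norm_le_rpow (C := 1) (α := 2) (by simp) (by simp; norm_num)
      (Eventually.of_forall fun x => ?_) (measurable_norm.pow_const _).aestronglyMeasurable
    rw [one_mul, Real.norm_of_nonneg (by positivity)]
  have h1 : LocallyIntegrable (fun x : Space => ‖x‖⁻¹) volume := by
    have := locallyIntegrable_newtonKernel_zero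
    rwa [show newtonKernel 0 = fun x => ‖x‖⁻¹ from funext newtonKernel_zero] at this
  exact (h2.integrable_smul_left_of_hasCompactSupport cutoff.continuous
    cutoff.hasCompactSupport).add (h1.integrable_smul_left_of_hasCompactSupport
      ((cutoff.contDiff (n := 1)).continuous_fderiv one_ne_zero).norm
      (cutoff.hasCompactSupport.fderiv ℝ).norm)

theorem tendsto_norm_sq_add_rpow {x : Space} (hx : x ≠ 0) (p : ℝ) :
    Tendsto (fun n : ℕ => (‖x‖ ^ 2 + ((n + 1 : ℝ)⁻¹) ^ 2) ^ p) atTop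
      (𝓝 ((‖x‖ ^ 2 + (0 : ℝ) ^ 2) ^ p)) := by
  have hx' : 0 < ‖x‖ := norm_pos_iff.2 hx
  have h0 : Tendsto (fun n : ℕ => (n + 1 : ℝ)⁻¹) atTop (𝓝 0) := by
    simpa using tendsto_one_div_add_atTop_nhds_zero_nat (𝕜 := ℝ)
  exact ((h0.pow 2).const_add _).rpow_const (Or.inl (by positivity))

theorem tendsto_gradCutKernel {x : Space} (hx : x ≠ 0) :
    Tendsto (fun n : ℕ => gradCutKernel (n + 1 : ℝ)⁻¹ x) atTop (𝓝 (gradCutKernel 0 x)) :=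
  (((tendsto_norm_sq_add_rpow hx _).neg.smul_const _).const_smul _).add
    ((tendsto_norm_sq_add_rpow hx _).smul_const _)

theorem tendsto_cutKernel {x : Space} (hx : x ≠ 0) :
    Tendsto (fun n : ℕ => cutKernel (n + 1 : ℝ)⁻¹ x) atTop (𝓝 (cutKernel 0 x)) :=
  (tendsto_norm_sq_add_rpow hx _).const_mul _

theorem continuous_gradCutKernel {ε : ℝ} (hε : 0 < ε) : Continuous (gradCutKernel ε) := by
  rw [← fderiv_cutKernel hε]
  exact (contDiff_cutKernel hε).continuous_fderiv (by simp)

theorem aestronglyMeasurable_gradCutKernel_zero :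
    AEStronglyMeasurable (gradCutKernel 0) volume :=
  aestronglyMeasurable_of_tendsto_ae atTop
    (fun n : ℕ => (continuous_gradCutKernel (ε := (n + 1 : ℝ)⁻¹)
      (by positivity)).aestronglyMeasurable)
    ((Measure.ae_ne volume (0 : Space)).mono fun _ hx => tendsto_gradCutKernel hx)

theorem integrable_gradCutKernel_zero : Integrable (gradCutKernel 0) :=
  integrable_gradCutKernel_bound.mono' aestronglyMeasurable_gradCutKernel_zero
    ((Measure.ae_ne volume (0 : Space)).mono fun _ hx => norm_gradCutKernel_le hx 0)

theorem hasCompactSupport_gradCutKernel (ε : ℝ) : HasCompactSupport (gradCutKernel ε) := by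
  refine HasCompactSupport.intro (K := tsupport cutoff) cutoff.hasCompactSupport fun x hx => ?_
  rw [gradCutKernel, image_eq_zero_of_notMem_tsupport hx, fderiv_of_notMem_tsupport ℝ hx, zero_smul,
    smul_zero, add_zero]

section Regularity

variable {F : Type*} [NormedAddCommGroup F] [NormedSpace ℝ F]
  {G : Type*} [NormedAddCommGroup G] [NormedSpace ℝ G]
  {H : Type*} [NormedAddCommGroup H] [NormedSpace ℝ H]

/-- The gradient of the Newtonian potential of a bounded function. -/
theorem cutKernel_convolution_hasFDerivAt {f : Space → F} (hf : EssBounded f) :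
    (∀ x, HasFDerivAt (cutKernel 0 ⋆[lsmul ℝ ℝ, volume] f)
      ((gradCutKernel 0 ⋆[(lsmul ℝ ℝ).precompL Space, volume] f) x) x) ∧
    Continuous (gradCutKernel 0 ⋆[(lsmul ℝ ℝ : ℝ →L[ℝ] F →L[ℝ] F).precompL Space, volume] f) := by
  have hpos : ∀ n : ℕ, (0 : ℝ) < (n + 1 : ℝ)⁻¹ := fun n => by positivity
  have hne : ∀ᵐ x : Space, x ≠ 0 := Measure.ae_ne volume 0
  have hgi : ∀ n : ℕ, Integrable (gradCutKernel (n + 1 : ℝ)⁻¹) := fun n =>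
    (continuous_gradCutKernel (hpos n)).integrable_of_hasCompactSupport
      (hasCompactSupport_gradCutKernel _)
  have hki : ∀ n : ℕ, Integrable (cutKernel (n + 1 : ℝ)⁻¹) := fun n =>
    (contDiff_cutKernel (hpos n)).continuous.integrable_of_hasCompactSupport
      (hasCompactSupport_cutKernel _)
  have hg := tendstoUniformly_convolution hf hgi integrable_gradCutKernel_zero
    (tendsto_integral_norm_sub_of_dominated (fun n => (hgi n).1) integrable_gradCutKernel_zero.1
      integrable_gradCutKernel_bound
      (fun n => hne.mono fun x hx => norm_gradCutKernel_le hx _)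
      (hne.mono fun x hx => norm_gradCutKernel_le hx 0)
      (hne.mono fun x hx => tendsto_gradCutKernel hx))
    ((lsmul ℝ ℝ : ℝ →L[ℝ] F →L[ℝ] F).precompL Space)
  have hk := tendstoUniformly_convolution hf hki integrable_cutKernel_zero
    (tendsto_integral_norm_sub_of_dominated (fun n => (hki n).1) integrable_cutKernel_zero.1
      integrable_cutKernel_zero
      (fun n => hne.mono fun x hx => norm_cutKernel_le hx _)
      (hne.mono fun x hx => norm_cutKernel_le hx 0)
      (hne.mono fun x hx => tendsto_cutKernel hx))
    (lsmul ℝ ℝ : ℝ →L[ℝ] F →L[ℝ] F)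
  -- The regularized kernels are smooth, and both their convolutions and the derivatives of these
  -- converge uniformly, so the limit may be differentiated.
  refine ⟨fun x => hasFDerivAt_of_tendstoUniformly hg (fun n x => ?_)
    (fun x => hk.tendsto_at x) x, hg.continuous (Frequently.of_forall fun n => ?_)⟩
  · rw [← fderiv_cutKernel (hpos n)]
    exact (hasCompactSupport_cutKernel _).hasFDerivAt_convolution_left (lsmul ℝ ℝ)
      ((contDiff_cutKernel (hpos n)).of_le one_le_smooth) hf.locallyIntegrable x
  · exact (hasCompactSupport_gradCutKernel _).continuous_convolution_left _
      (continuous_gradCutKernel (hpos n)) hf.locallyIntegrable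

/-- Convolution with a compactly supported integrable kernel preserves smoothness. -/
theorem contDiff_convolution_of_hasCompactSupport_kernel {n : ℕ∞} {f : Space → F}
    (hf : ContDiff ℝ n f) {k : Space → G} (hk : Integrable k) (hc : HasCompactSupport k)
    (L : G →L[ℝ] F →L[ℝ] H) [CompleteSpace H] : ContDiff ℝ n (k ⋆[L, volume] f) := by
  obtain ⟨R, hR⟩ := hc.isCompact.isBounded.subset_closedBall (0 : Space)
  rw [contDiff_iff_contDiffAt]
  intro x₀
  have hR0 : 0 < |R| + 1 := by positivity
  -- For x within 1 of `x₀` and t in the support of `k`, the point x - t lies where η = 1, so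
  -- replacing `f` by η`f` changes nothing near `x₀`.
  let η : ContDiffBump x₀ := ⟨|R| + 1, |R| + 2, hR0, by linarith⟩
  have hη : ContDiff ℝ n fun y => η y • f y := η.contDiff.smul hf
  have hηc : HasCompactSupport fun y => η y • f y := η.hasCompactSupport.smul_right
  refine (hηc.contDiff_convolution_right L hk.locallyIntegrable hη).contDiffAt.congr_of_eventuallyEq
    ?_
  filter_upwards [Metric.ball_mem_nhds x₀ one_pos] with x hx
  rw [convolution_def, convolution_def]
  refine integral_congr_ae (Eventually.of_forall fun t => ?_)
  simp only
  by_cases ht : t ∈ tsupport k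
  · have h1 : ‖t‖ ≤ R := by simpa using hR ht
    have h2 : x - t ∈ Metric.closedBall x₀ (|R| + 1) := by
      rw [Metric.mem_ball, dist_eq_norm] at hx
      rw [Metric.mem_closedBall, dist_eq_norm, show x - t - x₀ = (x - x₀) - t by abel]
      exact (norm_sub_le _ _).trans (by linarith [le_abs_self R])
    rw [η.one_of_mem_closedBall h2, one_smul]
  · rw [image_eq_zero_of_notMem_tsupport ht]
    simp

theorem contDiff_cutKernel_convolution_one {f : Space → F} (hf : EssBounded f) :
    ContDiff ℝ 1 (cutKernel 0 ⋆[lsmul ℝ ℝ, volume] f) := by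
  obtain ⟨h1, h2⟩ := cutKernel_convolution_hasFDerivAt hf
  refine contDiff_one_iff_hasFDerivAt.2 ⟨_, h2, h1⟩

theorem contDiff_laplacian_farKernel_convolution {u : Space → F} (hu : EssBounded u) :
    ContDiff ℝ ∞ (Δ farKernel ⋆[lsmul ℝ ℝ, volume] u) :=
  hasCompactSupport_laplacian_farKernel.contDiff_convolution_left (lsmul ℝ ℝ)
    contDiff_farKernel.laplacian hu.locallyIntegrable

theorem contDiff_parametrix_one {f u : Space → F} (hf : EssBounded f) (hu : EssBounded u) :
    ContDiff ℝ 1 (parametrix f u) :=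
  ((contDiff_cutKernel_convolution_one hf).add
    ((contDiff_laplacian_farKernel_convolution hu).of_le one_le_smooth)).const_smul _

variable [CompleteSpace F]

/-- The derivative is again a convolution of `f` with a compactly supported integrable kernel, so it
is as smooth as `f`. -/
theorem contDiff_cutKernel_convolution_succ {f : Space → F} (hf : EssBounded f) {n : ℕ}
    (hn : ContDiff ℝ n f) :
    ContDiff ℝ (n + 1 : ℕ) (cutKernel 0 ⋆[lsmul ℝ ℝ, volume] f) := by
  obtain ⟨h1, -⟩ := cutKernel_convolution_hasFDerivAt hf
  push_cast
  refine contDiff_succ_iff_hasFDerivAt.2 ⟨_, ?_, h1⟩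
  exact contDiff_convolution_of_hasCompactSupport_kernel (n := (n : ℕ∞)) hn
    integrable_gradCutKernel_zero (hasCompactSupport_gradCutKernel 0) _

theorem contDiff_parametrix_succ {f u : Space → F} (hf : EssBounded f) (hu : EssBounded u)
    {n : ℕ} (hn : ContDiff ℝ n f) : ContDiff ℝ (n + 1 : ℕ) (parametrix f u) :=
  ((contDiff_cutKernel_convolution_succ hf hn).add
    ((contDiff_laplacian_farKernel_convolution hu).of_le
      (WithTop.coe_le_coe.2 (le_top : ((n + 1 : ℕ) : ℕ∞) ≤ ⊤)))).const_smul _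

theorem ae_eq_parametrix_of_weak {f u : Space → F} (hf : EssBounded f) (hu : EssBounded u)
    (h : ∀ φ : Space → ℝ, ContDiff ℝ ∞ φ → HasCompactSupport φ →
      ∫ x, Δ φ x • u x = ∫ x, φ x • f x) :
    u =ᵐ[volume] parametrix f u :=
  ae_eq_parametrix hf hu (contDiff_cutKernel_convolution_one hf).continuous h

end Regularity

end SchrodingerPoisson

/-! ### Poisson's equation for the Newtonian potential -/

namespace SchrodingerPoisson

open scoped ContDiff Convolution
open ContinuousLinearMap (lsmul)

theorem norm_farKernel_le (x : Space) : ‖farKernel x‖ ≤ 1 := by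
  rw [farKernel, newtonKernel_zero, norm_mul, norm_inv, norm_norm,
    Real.norm_of_nonneg (sub_nonneg.2 cutoff.le_one)]
  rcases le_or_gt ‖x‖ 1 with hx | hx
  · have : x ∈ Metric.closedBall (0 : Space) cutoff.rIn := by simpa [cutoff] using hx
    rw [cutoff.one_of_mem_closedBall this, sub_self, zero_mul]
    exact zero_le_one
  · exact mul_le_one₀ (by linarith [cutoff.nonneg (x := x)]) (by positivity)
      (inv_le_one_of_one_le₀ hx.le)

theorem farKernel_neg (x : Space) : farKernel (-x) = farKernel x := by
  rw [farKernel, farKernel, cutoff.neg, newtonKernel, newtonKernel, norm_neg]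

theorem cutKernel_add_farKernel (x : Space) : cutKernel 0 x + farKernel x = newtonKernel 0 x := by
  rw [cutKernel, farKernel]
  ring

theorem integrable_farKernel_mul {h : Space → ℝ} (hi : Integrable h) (x : Space) :
    Integrable fun t => farKernel t * h (x - t) :=
  (hi.comp_sub_left x).bdd_mul contDiff_farKernel.continuous.aestronglyMeasurable
    (Eventually.of_forall norm_farKernel_le)

/-- The Newtonian potential of a bounded integrable density splits into a singular and a smooth
part. -/
theorem newtonKernel_convolution_eq {h : Space → ℝ} (hi : Integrable h) (hb : EssBounded h)
    (x : Space) :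
    (newtonKernel 0 ⋆[lsmul ℝ ℝ, volume] h) x =
      (cutKernel 0 ⋆[lsmul ℝ ℝ, volume] h) x + (farKernel ⋆[lsmul ℝ ℝ, volume] h) x := by
  rw [convolution_def, convolution_def, convolution_def,
    ← integral_add (hb.integrable_convolution integrable_cutKernel_zero (lsmul ℝ ℝ) x)
      (f := fun t => lsmul ℝ ℝ (cutKernel 0 t) (h (x - t)))
      (g := fun t => lsmul ℝ ℝ (farKernel t) (h (x - t))) (integrable_farKernel_mul hi x)]
  refine integral_congr_ae (Eventually.of_forall fun t => ?_)
  simp only [ContinuousLinearMap.lsmul_apply, ← cutKernel_add_farKernel, add_smul]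

theorem continuous_farKernel_convolution {h : Space → ℝ} (hi : Integrable h) :
    Continuous (farKernel ⋆[lsmul ℝ ℝ, volume] h) :=
  BddAbove.continuous_convolution_left_of_integrable (lsmul ℝ ℝ)
    ⟨1, by rintro _ ⟨x, rfl⟩; exact norm_farKernel_le x⟩ contDiff_farKernel.continuous hi

theorem norm_farKernel_convolution_le {h : Space → ℝ} (hi : Integrable h) (x : Space) :
    ‖(farKernel ⋆[lsmul ℝ ℝ, volume] h) x‖ ≤ ∫ y, ‖h y‖ := by
  rw [convolution_eq_swap]
  refine norm_integral_le_of_norm_le hi.norm (Eventually.of_forall fun y => ?_)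
  rw [ContinuousLinearMap.lsmul_apply, norm_smul]
  exact mul_le_of_le_one_left (norm_nonneg _) (norm_farKernel_le _)

theorem continuous_newtonKernel_convolution {h : Space → ℝ} (hi : Integrable h)
    (hb : EssBounded h) : Continuous (newtonKernel 0 ⋆[lsmul ℝ ℝ, volume] h) := by
  rw [funext (newtonKernel_convolution_eq hi hb)]
  exact (contDiff_cutKernel_convolution_one hb).continuous.add (continuous_farKernel_convolution hi)

/-- `integral_convolution_smul` does not apply, since the far kernel decays only like 1/|x|. Here
the kernel is bounded and both functions are integrable. -/
theorem integral_farKernel_convolution_mul {h φ : Space → ℝ} (hi : Integrable h)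
    (hφ : Integrable φ) :
    ∫ x, (farKernel ⋆[lsmul ℝ ℝ, volume] φ) x * h x =
      ∫ y, φ y * (farKernel ⋆[lsmul ℝ ℝ, volume] h) y := by
  have h0 : Integrable (fun p : Space × Space => farKernel (p.1 - p.2) * (h p.1 * φ p.2))
      (volume.prod volume) :=
    (hi.mul_prod hφ).bdd_mul (contDiff_farKernel.continuous.comp
      (continuous_fst.sub continuous_snd)).aestronglyMeasurable
      (Eventually.of_forall fun p => norm_farKernel_le _)
  calc ∫ x, (farKernel ⋆[lsmul ℝ ℝ, volume] φ) x * h x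
      = ∫ x, ∫ y, farKernel (x - y) * (h x * φ y) := by
        refine integral_congr_ae (Eventually.of_forall fun x => ?_)
        simp only [convolution_eq_swap, ContinuousLinearMap.lsmul_apply, smul_eq_mul]
        rw [← integral_mul_const]
        refine integral_congr_ae (Eventually.of_forall fun y => ?_)
        simp only
        ring
    _ = ∫ y, ∫ x, farKernel (x - y) * (h x * φ y) := integral_integral_swap h0
    _ = ∫ y, φ y * (farKernel ⋆[lsmul ℝ ℝ, volume] h) y := by
        refine integral_congr_ae (Eventually.of_forall fun y => ?_)
        simp only [convolution_eq_swap, ContinuousLinearMap.lsmul_apply, smul_eq_mul]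
        rw [← integral_const_mul]
        refine integral_congr_ae (Eventually.of_forall fun x => ?_)
        simp only
        rw [← farKernel_neg (y - x), neg_sub]
        ring

/-- The Newtonian potential solves the Poisson equation in the weak sense. -/
theorem integral_laplacian_mul_newtonKernel_convolution {h : Space → ℝ} (hi : Integrable h)
    (hb : EssBounded h) {φ : Space → ℝ} (hφ : ContDiff ℝ ∞ φ) (hc : HasCompactSupport φ) :
    ∫ x, Δ φ x * (newtonKernel 0 ⋆[lsmul ℝ ℝ, volume] h) x = -(newtonMass * ∫ x, φ x * h x) := by
  have hLc : HasCompactSupport (Δ φ) := hasCompactSupport_laplacian hc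
  have hLi : Integrable (Δ φ) := hφ.laplacian.continuous.integrable_of_hasCompactSupport hLc
  have hLb : EssBounded (Δ φ) := by
    obtain ⟨M, hM⟩ := hLc.exists_bound_of_continuous hφ.laplacian.continuous
    exact ⟨hLi.1, M, Eventually.of_forall hM⟩
  have hL : ∀ x, (newtonKernel 0 ⋆[lsmul ℝ ℝ, volume] Δ φ) x = -(newtonMass * φ x) := fun x => by
    have hφx : ContDiff ℝ ∞ fun t => φ (x - t) := hφ.comp (contDiff_const.sub contDiff_id)
    have hcx : HasCompactSupport fun t => φ (x - t) := hc.comp_homeomorph (Homeomorph.subLeft x)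
    have := integral_newtonKernel_mul_laplacian hφx hcx
    simp only [laplacian_comp_const_sub (hφ.of_le two_le_smooth), sub_zero] at this
    exact this
  have hcont1 : Continuous fun x => Δ φ x * (cutKernel 0 ⋆[lsmul ℝ ℝ, volume] h) x :=
    hφ.laplacian.continuous.mul (contDiff_cutKernel_convolution_one hb).continuous
  have hcont2 : Continuous fun x => Δ φ x * (farKernel ⋆[lsmul ℝ ℝ, volume] h) x :=
    hφ.laplacian.continuous.mul (continuous_farKernel_convolution hi)
  have hcont3 : Continuous (farKernel ⋆[lsmul ℝ ℝ, volume] Δ φ) :=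
    continuous_farKernel_convolution hLi
  have hcont4 : Continuous (cutKernel 0 ⋆[lsmul ℝ ℝ, volume] Δ φ) :=
    (contDiff_cutKernel_convolution_one hLb).continuous
  simp only [newtonKernel_convolution_eq hi hb, mul_add]
  rw [integral_add (hcont1.integrable_of_hasCompactSupport hLc.mul_right)
    (hcont2.integrable_of_hasCompactSupport hLc.mul_right),
    ← integral_farKernel_convolution_mul hi hLi]
  have h1 := integral_convolution_smul hb integrable_cutKernel_zero (cutKernel_neg 0) hLi
  simp only [smul_eq_mul] at h1
  rw [← h1, ← integral_add, ← integral_const_mul, ← integral_neg]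
  · refine integral_congr_ae (Eventually.of_forall fun x => ?_)
    simp only
    rw [← add_mul, ← newtonKernel_convolution_eq hLi hLb, hL]
    ring
  · have h2 := integrable_cutKernel_zero.integrable_convolution (lsmul ℝ ℝ) hLi
    obtain ⟨hm, M, hM⟩ := hb
    exact h2.mul_bdd hm hM
  · exact hi.bdd_mul hcont3.aestronglyMeasurable
      (Eventually.of_forall (norm_farKernel_convolution_le hLi))

end SchrodingerPoisson

/-! ### Bootstrap to a classical solution -/

namespace SchrodingerPoisson

open scoped ContDiff Convolution
open ContinuousLinearMap (lsmul)

theorem gravIntegrand_congr {m : ℕ} {u w : Space → Target m} (h : u =ᵐ[volume] w) (x : Space) :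
    gravIntegrand u x =ᵐ[volume] gravIntegrand w x := by
  filter_upwards [h] with y hy
  rw [gravIntegrand, gravIntegrand, hy]

theorem gravPotential_congr {m : ℕ} {u w : Space → Target m} (h : u =ᵐ[volume] w) :
    gravPotential u = gravPotential w := by
  ext x
  rw [gravPotential, gravPotential, integral_congr_ae (gravIntegrand_congr h x)]

theorem gravPotential_eq_convolution {m : ℕ} (u : Space → Target m) (x : Space) :
    gravPotential u x =
      -(1 / (4 * Real.pi)) * (newtonKernel 0 ⋆[lsmul ℝ ℝ, volume] fun y => ‖u y‖ ^ 2) x := by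
  rw [gravPotential, convolution_eq_swap]
  congr 1
  refine integral_congr_ae (Eventually.of_forall fun y => ?_)
  simp only [gravIntegrand, ContinuousLinearMap.lsmul_apply, newtonKernel_zero, smul_eq_mul,
    div_eq_inv_mul]

/-- Transfers the distributional equation to real test functions, the form in which the parametrix
uses it. -/
theorem integral_laplacian_smul_of_laplacian_eq {m : ℕ} {u g : L2 m}
    (h : Δ (u : 𝓢'(Space, Target m)) = (g : 𝓢'(Space, Target m))) {φ : Space → ℝ}
    (hφ : ContDiff ℝ ∞ φ) (hc : HasCompactSupport φ) :
    ∫ x, Δ φ x • u x = ∫ x, φ x • g x := by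
  have hL : Δ (testFunction hφ hc) =
      testFunction hφ.laplacian (hasCompactSupport_laplacian hc) := by
    ext x
    rw [SchwartzMap.laplacian_apply, testFunction_apply]
    exact (hφ.of_le two_le_smooth).contDiffAt.laplacian_CLM_comp_left (l := Complex.ofRealCLM)
  rw [← toTemperedDistribution_testFunction g hφ hc, ← h,
    TemperedDistribution.laplacian_apply_apply, hL, toTemperedDistribution_testFunction]

theorem EssBounded.smul {F : Type*} [NormedAddCommGroup F] [NormedSpace ℝ F] {a : Space → ℝ}
    {f : Space → F} (ha : EssBounded a) (hf : EssBounded f) : EssBounded fun x => a x • f x := by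
  obtain ⟨ham, A, hA⟩ := ha
  obtain ⟨hfm, B, hB⟩ := hf
  refine ⟨ham.smul hfm, A * B, ?_⟩
  filter_upwards [hA, hB] with x h1 h2
  rw [norm_smul]
  exact mul_le_mul h1 h2 (norm_nonneg _) ((norm_nonneg _).trans h1)

theorem EssBounded.congr {F : Type*} [NormedAddCommGroup F] {f g : Space → F} (hf : EssBounded f)
    (h : f =ᵐ[volume] g) : EssBounded g := by
  obtain ⟨hm, M, hM⟩ := hf
  refine ⟨hm.congr h, M, ?_⟩
  filter_upwards [h, hM] with x h1 h2
  rwa [← h1]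

theorem EssBounded.norm_sq {F : Type*} [NormedAddCommGroup F] {f : Space → F}
    (hf : EssBounded f) : EssBounded fun x => ‖f x‖ ^ 2 := by
  obtain ⟨hm, M, hM⟩ := hf
  refine ⟨hm.norm.pow 2, M ^ 2, ?_⟩
  filter_upwards [hM] with x h
  rw [norm_pow, norm_norm]
  gcongr

theorem EssBounded.const_mul {f : Space → ℝ} (hf : EssBounded f) (c : ℝ) :
    EssBounded fun x => c * f x := by
  obtain ⟨hm, M, hM⟩ := hf
  refine ⟨hm.const_mul c, |c| * M, ?_⟩
  filter_upwards [hM] with x h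
  rw [norm_mul, Real.norm_eq_abs c]
  gcongr

theorem EssBounded.sub_const {f : Space → ℝ} (hf : EssBounded f) (c : ℝ) :
    EssBounded fun x => f x - c := by
  obtain ⟨hm, M, hM⟩ := hf
  refine ⟨hm.sub aestronglyMeasurable_const, M + |c|, ?_⟩
  filter_upwards [hM] with x h
  exact (norm_sub_le _ _).trans (add_le_add h le_rfl)

/-- A bounded function which satisfies the weak Schrödinger–Poisson system has a smooth
representative. -/
theorem exists_contDiff_of_weak {m : ℕ} {u : Space → Target m} {lam : ℝ} (hu : EssBounded u)
    (hi : Integrable fun x => ‖u x‖ ^ 2) (hU : EssBounded (gravPotential u))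
    (h : ∀ φ : Space → ℝ, ContDiff ℝ ∞ φ → HasCompactSupport φ →
      ∫ x, Δ φ x • u x = ∫ x, φ x • ((gravPotential u x - lam) • u x)) :
    ∃ w : Space → Target m, u =ᵐ[volume] w ∧ ContDiff ℝ ∞ w ∧ ContDiff ℝ ∞ (gravPotential w) ∧
      ∀ x, Δ w x = (gravPotential w x - lam) • w x := by
  set w := parametrix (fun x => (gravPotential u x - lam) • u x) u with hw
  have huw : u =ᵐ[volume] w := ae_eq_parametrix_of_weak ((hU.sub_const lam).smul hu) hu h
  have hw1 : ContDiff ℝ 1 w := contDiff_parametrix_one ((hU.sub_const lam).smul hu) hu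
  clear_value w
  -- The potentials agree at every point, as they depend only on the class of the function modulo
  -- null sets.
  have hUw := gravPotential_congr huw
  have hwb : EssBounded w := hu.congr huw
  rw [hUw] at hU h
  have hwk : ∀ φ : Space → ℝ, ContDiff ℝ ∞ φ → HasCompactSupport φ →
      ∫ x, Δ φ x • w x = ∫ x, φ x • ((gravPotential w x - lam) • w x) := fun φ hφ hc => by
    have h1 : ∫ x, Δ φ x • w x = ∫ x, Δ φ x • u x :=
      integral_congr_ae (by filter_upwards [huw] with x hx; rw [hx])
    rw [h1, h φ hφ hc]
    exact integral_congr_ae (by filter_upwards [huw] with x hx; rw [hx])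
  have hwi : Integrable fun x => ‖w x‖ ^ 2 := hi.congr (by
    filter_upwards [huw] with x hx
    rw [hx])
  set U := gravPotential w with hUdef
  have hUeq := funext (gravPotential_eq_convolution w)
  rw [← hUdef] at hUeq
  have hUc : Continuous U := by
    rw [hUeq]
    exact (continuous_newtonKernel_convolution hwi hwb.norm_sq).const_mul _
  set c : ℝ := newtonMass / (4 * Real.pi) with hc
  have hUk : ∀ φ : Space → ℝ, ContDiff ℝ ∞ φ → HasCompactSupport φ →
      ∫ x, Δ φ x • U x = ∫ x, φ x • (c * ‖w x‖ ^ 2) := fun φ hφ hφc => by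
    have h1 := integral_laplacian_mul_newtonKernel_convolution hwi hwb.norm_sq hφ hφc
    simp only [hUeq, smul_eq_mul, mul_left_comm _ (-(1 / (4 * Real.pi))), mul_left_comm _ c]
    rw [integral_const_mul, integral_const_mul, h1, hc]
    ring
  have hf : EssBounded fun x => (U x - lam) • w x := (hU.sub_const lam).smul hwb
  have hg : EssBounded fun x => c * ‖w x‖ ^ 2 := hwb.norm_sq.const_mul c
  -- Both sides are continuous, so the identity holds everywhere. It can therefore be
  -- differentiated, and likewise the one for `U`.
  have hwp : w = parametrix (fun x => (U x - lam) • w x) w :=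
    (hw1.continuous.ae_eq_iff_eq volume (contDiff_parametrix_one hf hwb).continuous).1
      (ae_eq_parametrix_of_weak hf hwb hwk)
  have hUp : U = parametrix (fun x => c * ‖w x‖ ^ 2) U :=
    (hUc.ae_eq_iff_eq volume (contDiff_parametrix_one hg hU).continuous).1
      (ae_eq_parametrix_of_weak hg hU hUk)
  -- The two orders must rise together: the source for `w` contains `U`, and the source for `U` is a
  -- multiple of |w|².
  have hn : ∀ n : ℕ, ContDiff ℝ n w ∧ ContDiff ℝ n U := by
    intro n
    induction n with
    | zero => exact ⟨contDiff_zero.2 hw1.continuous, contDiff_zero.2 hUc⟩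
    | succ n ih =>
      obtain ⟨ihw, ihU⟩ := ih
      constructor
      · rw [hwp]
        exact contDiff_parametrix_succ hf hwb ((ihU.sub contDiff_const).smul ihw)
      · rw [hUp]
        exact contDiff_parametrix_succ hg hU (contDiff_const.mul (ihw.norm_sq ℝ))
  have hws : ContDiff ℝ ∞ w := contDiff_infty.2 fun n => (hn n).1
  have hUs : ContDiff ℝ ∞ U := contDiff_infty.2 fun n => (hn n).2
  refine ⟨w, huw, hws, hUs, fun x => ?_⟩
  have hcl : Continuous (Δ w) := hws.laplacian.continuous
  have hcr : Continuous fun x => (U x - lam) • w x :=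
    (hUc.sub continuous_const).smul hw1.continuous
  refine congrFun ((hcl.ae_eq_iff_eq volume hcr).1 ?_) x
  refine ae_eq_of_integral_contDiff_smul_eq hcl.locallyIntegrable hcr.locallyIntegrable
    fun φ hφ hφc => ?_
  rw [← integral_laplacian_smul_eq (hws.of_le two_le_smooth) (hφ.of_le two_le_smooth) hφc]
  exact hwk φ hφ hφc

theorem IsWeakSolution.exists_isClassicalSolution {m : ℕ} {V : Space → ℝ}
    (hV : IsAdmissiblePotential V) (hV0 : ∀ x, V x = 0) {lam : ℝ} {u : L2 m}
    (hu : IsWeakSolution V lam u) :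
    ∃ w : Space → Target m, u =ᵐ[volume] w ∧ ContDiff ℝ ∞ w ∧ IsClassicalSolution V lam w := by
  obtain ⟨k, hk, Lu, hLu, hae⟩ := hu.exists_resolvent hV
  obtain ⟨C, -, hb⟩ := exists_resolvent_bound m
  have hB : ∀ᵐ x, ‖u x‖ ≤ C * ‖k‖ := by
    have := hb k
    rwa [← hk] at this
  obtain ⟨hint, M, hM⟩ := gravPotential_bounded u hB
  obtain ⟨w, huw, hw, -, hΔ⟩ := exists_contDiff_of_weak (lam := lam)
    ⟨Lp.aestronglyMeasurable u, _, hB⟩ (integrable_norm_sq u)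
    ⟨aestronglyMeasurable_gravPotential u, M, Eventually.of_forall hM⟩ fun φ hφ hc => by
      rw [integral_laplacian_smul_of_laplacian_eq hLu hφ hc]
      refine integral_congr_ae ?_
      filter_upwards [hae] with x hx
      rw [hx, hV0, zero_add]
  refine ⟨w, huw, hw, hw.of_le two_le_smooth,
    fun x => (hint x).congr (gravIntegrand_congr huw x), fun x => ?_⟩
  rw [hΔ, hV0]
  module

end SchrodingerPoisson

theorem theorem5p6 (m : ℕ) (V : SchrodingerPoisson.Space → ℝ)
    (hV : SchrodingerPoisson.IsAdmissiblePotential V) (ω : ℝ) (hω : ω < 0)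
    (u : SchrodingerPoisson.L2 m) (hu : SchrodingerPoisson.IsWeakSolution V ω u) :
    (SchrodingerPoisson.MemH 2 u ∧ SchrodingerPoisson.IsStrongSolution V ω u) ∧
    ((∀ x, V x = 0) →
      ∃ w : SchrodingerPoisson.Space → SchrodingerPoisson.Target m,
        u =ᵐ[volume] w ∧ ContDiff ℝ ((⊤ : ℕ∞) : WithTop ℕ∞) w ∧ SchrodingerPoisson.IsClassicalSolution V ω w) :=
  ⟨⟨(hu.isStrongSolution hV).1, hu.isStrongSolution hV⟩,
    fun hV0 => hu.exists_isClassicalSolution hV hV0⟩
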